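/- Let $k$ be a field, let $\mathbb{P}=\{1,2,3,\dots\}$, and let $r\ge 1$. Let $\Lambda$ be a stack polyomino, that is, a finite subset of $\mathbb{P}^2$ such that (i) if $(a,b)\in\Lambda$ then $(c,b)\in\Lambda$ for $1\le c\le a$, and (ii) if $(a,b_1),(a,b_2)\in\Lambda$ and $b_1\le d\le b_2$ then $(a,d)\in\Lambda$. Let $R_\Lambda=k[x_{ab}:(a,b)\in\Lambda]$, and let $D_{\Lambda,r}\subseteq R_\Lambda$ be the ideal generated by the minors $\det(x_{ab})_{a\in\alpha,\,b\in\beta}$ for all $\alpha,\beta\subset\mathbb{P}$ with $|\alpha|=|\beta|=r$ and $\alpha\times\beta\subseteq\Lambda$. Order the variables by $x_{ij}\prec x_{kl}$ if $i>k$, or if $i=k$ and $j<l$, and extend $\preceq$ to monomials by the graded reverse lexicographic term order: $m\prec m'$ if and only if $\deg m<\deg m'$, or $\deg m=\deg m'$ and, at the $\prec$-smallest variable whose exponents in $m$ and $m'$ differ, the exponent in $m$ is the larger one. For an ideal $J\subseteq R_\Lambda$ let $\mathrm{in}_\preceq(J)$ be the ideal generated by the leading monomials of the nonzero elements of $J$.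 An $r$-diagonal in $\Lambda$ is a set $\{(a_1,b_1),\dots,(a_r,b_r)\}$ with $a_1<\dots<a_r$, $b_1<\dots<b_r$ and $(a_i,b_j)\in\Lambda$ for all $1\le i,j\le r$. Let $\Delta_{\Lambda,r-1}$ be the simplicial complex of all subsets of $\Lambda$ that contain no $r$-diagonal in $\Lambda$, and let $I_{\Delta_{\Lambda,r-1}}\subseteq R_\Lambda$ be its Stanley--Reisner ideal, generated by the monomials $\prod_{(a,b)\in\sigma}x_{ab}$ for all $\sigma\subseteq\Lambda$ with $\sigma\notin\Delta_{\Lambda,r-1}$. Then $$\mathrm{in}_\preceq(D_{\Lambda,r}) = I_{\Delta_{\Lambda,r-1}}.$$ In particular, $\mathrm{in}_\preceq(D_{\Lambda,r})$ is generated by squarefree monomials. -/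

import Mathlib

/-! ### The graded reverse lexicographic order -/

/-- Exponent vectors, to be ordered by the graded reverse lexicographic order. -/
def DegRevLex (V : Type*) := V →₀ ℕ

namespace DegRevLex

variable {V : Type*}

noncomputable instance : AddCommMonoid (DegRevLex V) :=
  inferInstanceAs (AddCommMonoid (V →₀ ℕ))

/-- The identity, from exponent vectors to their ordered synonym. -/
noncomputable def equiv : (V →₀ ℕ) ≃+ DegRevLex V := AddEquiv.refl _

/-- The key that is compared: first the degree, then the exponent vectors in the reversed
lexicographic order, where the entry at the smallest variable is compared first. -/
noncomputable def key [LinearOrder V] (m : DegRevLex V) : ℕ ×ₗ (Lex (V →₀ ℕ))ᵒᵈ :=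
  toLex (Finsupp.degree (equiv.symm m), OrderDual.toDual (toLex (equiv.symm m)))

theorem key_injective [LinearOrder V] : Function.Injective (key : DegRevLex V → _) := by
  intro m n h
  have h2 := congrArg (fun p => ofLex (OrderDual.ofDual (ofLex p).2)) h
  exact h2

noncomputable instance [LinearOrder V] : LinearOrder (DegRevLex V) :=
  LinearOrder.lift' key key_injective

theorem lt_def [LinearOrder V] {m n : V →₀ ℕ} :
    equiv m < equiv n ↔ m.degree < n.degree ∨
      (m.degree = n.degree ∧ ∃ i, (∀ j < i, m j = n j) ∧ n i < m i) := by
  change key (equiv m) < key (equiv n) ↔ _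
  simp only [key, AddEquiv.symm_apply_apply, Prod.Lex.toLex_lt_toLex, OrderDual.toDual_lt_toDual,
    Finsupp.Lex.lt_iff, ofLex_toLex]
  simp only [eq_comm]

theorem le_def [LinearOrder V] {m n : V →₀ ℕ} :
    equiv m ≤ equiv n ↔ m.degree < n.degree ∨
      (m.degree = n.degree ∧ toLex n ≤ toLex m) := by
  change key (equiv m) ≤ key (equiv n) ↔ _
  simp only [key, AddEquiv.symm_apply_apply, Prod.Lex.toLex_le_toLex, OrderDual.toDual_le_toDual]

instance [LinearOrder V] : IsOrderedAddMonoid (DegRevLex V) where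
  add_le_add_left a b h c := by
    obtain ⟨a, rfl⟩ := equiv.surjective a
    obtain ⟨b, rfl⟩ := equiv.surjective b
    obtain ⟨c, rfl⟩ := equiv.surjective c
    rw [← map_add, ← map_add]
    rw [le_def] at h ⊢
    simpa [toLex_add] using h

instance [LinearOrder V] [Finite V] : WellFoundedLT (DegRevLex V) := by
  have : ∀ x : DegRevLex V, (Set.Iio x).Finite := by
    intro x
    refine (Finsupp.finite_of_degree_le (σ := V) (Finsupp.degree (equiv.symm x))).subset ?_
    intro y hy
    have hy' : equiv (equiv.symm y) < equiv (equiv.symm x) := hy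
    rw [lt_def] at hy'
    rcases hy' with h | h
    · exact h.le
    · exact h.1.le
  refine ⟨Subrelation.wf (r := (measure fun x : DegRevLex V => (Set.Iio x).ncard).rel) ?_
    (measure _).wf⟩
  intro y x h
  exact Set.ncard_lt_ncard (Set.Iio_ssubset_Iio h) (this x)

end DegRevLex

/-- The graded reverse lexicographic term order on the monomials in the variables `V`: the monomial
`m` is smaller than `n` if its degree is smaller, or if the degrees agree and, at the smallest
variable where the exponents differ, `m` has the larger exponent. Equivalently, for equal degrees,
the word of the variables of `m` in increasing order is lexicographically smaller than that
of `n`. -/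
noncomputable def degRevLex (V : Type*) [LinearOrder V] [Finite V] : MonomialOrder V where
  syn := DegRevLex V
  toSyn := DegRevLex.equiv
  toSyn_monotone a b h := by
    rcases h.eq_or_lt with rfl | h
    · exact le_rfl
    · rw [DegRevLex.le_def]
      left
      obtain ⟨c, rfl⟩ := exists_add_of_le h.le
      have hc : c ≠ 0 := by rintro rfl; simp at h
      have : c.degree ≠ 0 := by simpa [Finsupp.degree_eq_zero_iff] using hc
      rw [map_add]
      omega

/-! ### Initial ideals and Stanley-Reisner ideals -/

/-- The leading monomial of `f` (with coefficient one), which is `0` for `f = 0`. -/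
noncomputable def leadingMonomial {V k : Type*} [Field k] (ord : MonomialOrder V)
    (f : MvPolynomial V k) : MvPolynomial V k :=
  open Classical in if f = 0 then 0 else MvPolynomial.monomial (ord.degree f) 1

/-- The initial ideal of `J`, generated by the leading monomials of all elements of `J`. -/
noncomputable def initialIdeal {V k : Type*} [Field k] (ord : MonomialOrder V)
    (J : Ideal (MvPolynomial V k)) : Ideal (MvPolynomial V k) :=
  Ideal.span {g | ∃ f ∈ J, g = leadingMonomial ord f}

/-- The Stanley-Reisner ideal of a simplicial complex `Δ` on the ground set `V`, that is, of a
family of finite subsets of `V` that is closed under taking subsets. It is generated by the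
squarefree monomials of the nonfaces. -/
noncomputable def stanleyReisnerIdeal {V : Type*} (k : Type*) [Field k]
    (Δ : LowerSet (Finset V)) : Ideal (MvPolynomial V k) :=
  Ideal.span {f | ∃ σ : Finset V, σ ∉ Δ ∧ f = ∏ v ∈ σ, MvPolynomial.X v}

/-- `I` is generated by a set of squarefree monomials. -/
def IsSquarefreeMonomialIdeal {V k : Type*} [Field k] (I : Ideal (MvPolynomial V k)) : Prop :=
  ∃ S : Set (V →₀ ℕ), (∀ m ∈ S, ∀ v, m v ≤ 1) ∧
    I = Ideal.span ((fun m => MvPolynomial.monomial m (1 : k)) '' S)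

/-! ### Stack polyominoes and their minors -/

/-- Stack polyominoes: finite sets of positions `(row, column)` of which each column is an
initial segment and each row is an interval. -/
structure IsStackPolyomino (Λ : Finset (ℕ+ × ℕ+)) : Prop where
  column : ∀ a b, (a, b) ∈ Λ → ∀ c ≤ a, (c, b) ∈ Λ
  row : ∀ a b₁ b₂, (a, b₁) ∈ Λ → (a, b₂) ∈ Λ → ∀ d, b₁ ≤ d → d ≤ b₂ → (a, d) ∈ Λ

/-- The elements of `Λ`, as indices of variables. This is a separate type since its order is not
the componentwise one. -/
def Cell (Λ : Finset (ℕ+ × ℕ+)) : Type := {p : ℕ+ × ℕ+ // p ∈ Λ}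

namespace Cell

variable {Λ : Finset (ℕ+ × ℕ+)}

instance : Finite (Cell Λ) := inferInstanceAs (Finite {p : ℕ+ × ℕ+ // p ∈ Λ})

/-- The position of a cell. -/
def pos : Cell Λ ↪ ℕ+ × ℕ+ := ⟨Subtype.val, Subtype.val_injective⟩

/-- Lower rows come first, and each row is ordered from left to right. -/
noncomputable instance : LinearOrder (Cell Λ) :=
  LinearOrder.lift' (fun x : Cell Λ => toLex (OrderDual.toDual (pos x).1, (pos x).2))
    (fun x y h => by
      have h' := toLex.injective h
      simp only [Prod.mk.injEq, EmbeddingLike.apply_eq_iff_eq] at h'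
      exact pos.injective (Prod.ext h'.1 h'.2))

theorem lt_def {x y : Cell Λ} :
    x < y ↔ (pos x).1 > (pos y).1 ∨ ((pos x).1 = (pos y).1 ∧ (pos x).2 < (pos y).2) := by
  change toLex (OrderDual.toDual (pos x).1, (pos x).2) <
    toLex (OrderDual.toDual (pos y).1, (pos y).2) ↔ _
  simp [Prod.Lex.toLex_lt_toLex]

end Cell

/-- The matrix with the variable `x_{ab}` at the positions `(a, b) ∈ Λ` and `0` elsewhere. -/
noncomputable def genericMatrix (k : Type*) [Field k] (Λ : Finset (ℕ+ × ℕ+)) :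
    Matrix ℕ+ ℕ+ (MvPolynomial (Cell Λ) k) :=
  fun a b => if h : (a, b) ∈ Λ then MvPolynomial.X (⟨(a, b), h⟩ : Cell Λ) else 0

/-- The minor with row set `α` and column set `β` if `α × β` lies in `Λ`, and `0` otherwise. -/
noncomputable def minorOf (k : Type*) [Field k] (Λ : Finset (ℕ+ × ℕ+)) {r : ℕ}
    (α β : Finset ℕ+) (hα : α.card = r) (hβ : β.card = r) : MvPolynomial (Cell Λ) k :=
  if α ×ˢ β ⊆ Λ then
    ((genericMatrix k Λ).submatrix (α.orderEmbOfFin hα) (β.orderEmbOfFin hβ)).det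
  else 0

/-- The ideal generated by the `r`-minors that lie in `Λ`. -/
noncomputable def determinantalIdeal (k : Type*) [Field k] (Λ : Finset (ℕ+ × ℕ+)) (r : ℕ) :
    Ideal (MvPolynomial (Cell Λ) k) :=
  Ideal.span {f | ∃ (α β : Finset ℕ+) (hα : α.card = r) (hβ : β.card = r),
    f = minorOf k Λ α β hα hβ}

/-- The set `τ` forms an `r`-diagonal in `Λ`. -/
def IsDiagonal (Λ : Finset (ℕ+ × ℕ+)) (r : ℕ) (τ : Finset (ℕ+ × ℕ+)) : Prop :=
  ∃ a b : Fin r → ℕ+, StrictMono a ∧ StrictMono b ∧ (∀ i j, (a i, b j) ∈ Λ) ∧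
    τ = Finset.univ.image fun i => (a i, b i)

/-- The simplicial complex of all subsets of `Λ` that contain no `r`-diagonal in `Λ`. For `r ≥ 1`
this is the complex written `Δ_{Λ, r-1}`. -/
def diagonalFreeComplex (Λ : Finset (ℕ+ × ℕ+)) (r : ℕ) : LowerSet (Finset (Cell Λ)) where
  carrier := {σ | ¬ ∃ τ, IsDiagonal Λ r τ ∧ τ ⊆ σ.map Cell.pos}
  lower' := fun _ _ hst hs ⟨τ, hτ, h⟩ => hs ⟨τ, hτ, h.trans (Finset.map_subset_map.2 hst)⟩

/-!
The leading term of a minor is its diagonal term, so one has to show that a polynomial in the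
determinantal ideal is zero if none of its monomials contains a diagonal. Moving the rows and
columns apart, one embeds the polyomino in the staircase of the cells `(a, b)` with `a < b ≤ n`.
Products of the matrices with a block `[0, 1; 1, x]` along a reduced word of the longest permutation
have the staircase variables as their entries below the antidiagonal. If such a product lies in the
opposite Bruhat cell of the permutation that reverses all but the first and the last `r - 1`
elements, then its `r`-minors below the antidiagonal vanish, and so does the polynomial.

The vanishing is then exploited one variable at a time: a variable that does not occur is chosen
such that the remaining product lies in a cell given by one step of bubble sort, and a variable that
occurs is sent to infinity, which skips this step and leaves the leading coefficient. If a monomial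
contains no diagonal, then the remaining steps still sort the permutation completely, so at the end
a nonzero constant would have to vanish.
-/

/-! ### Opposite Bruhat cells -/

section CrossMatrix

open Matrix

variable {R S : Type*} [CommRing R] [CommRing S] {n : ℕ}

/-- The matrix that agrees with the identity except for the block `[0, 1; 1, x]` at the positions
`j, j + 1`. Products of such matrices parametrize Bruhat cells. -/
def crossMatrix (j : Fin n) (x : R) : Matrix (Fin (n + 1)) (Fin (n + 1)) R :=
  swap R j.castSucc j.succ * transvection j.castSucc j.succ x

theorem castSucc_ne_succ (j : Fin n) : j.castSucc ≠ j.succ := Fin.castSucc_lt_succ.ne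

theorem isUnit_crossMatrix (j : Fin n) (x : R) : IsUnit (crossMatrix j x) := by
  rw [isUnit_iff_isUnit_det, crossMatrix, det_mul,
    det_transvection_of_ne _ _ (castSucc_ne_succ j), mul_one]
  exact isUnit_det_of_left_inverse (swap_mul_self _ _)

theorem map_transvection {m : Type*} [DecidableEq m] (φ : R →+* S) (i j : m) (x : R) :
    (transvection i j x).map φ = transvection i j (φ x) := by
  simp [transvection, Matrix.map_add]

theorem map_crossMatrix (φ : R →+* S) (j : Fin n) (x : R) :
    (crossMatrix j x).map φ = crossMatrix j (φ x) := by
  rw [crossMatrix, Matrix.map_mul, map_swap, map_transvection, crossMatrix]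

theorem crossMatrix_mul_apply {m : Type*} (j : Fin n) (x : R) (M : Matrix (Fin (n + 1)) m R)
    (a : Fin (n + 1)) (c : m) :
    (crossMatrix j x * M) a c =
      if a = j.castSucc then M j.succ c
      else if a = j.succ then M j.castSucc c + x * M j.succ c else M a c := by
  have hj := castSucc_ne_succ j
  rw [crossMatrix, Matrix.mul_assoc]
  split_ifs with h h'
  · rw [h, swap_mul_apply_left, transvection_mul_apply_of_ne _ _ _ _ hj.symm]
  · rw [h', swap_mul_apply_right, transvection_mul_apply_same]
  · rw [swap_mul_of_ne h h', transvection_mul_apply_of_ne _ _ _ _ h]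

theorem mul_crossMatrix_apply {m : Type*} (j : Fin n) (x : R) (M : Matrix m (Fin (n + 1)) R)
    (a : m) (c : Fin (n + 1)) :
    (M * crossMatrix j x) a c =
      if c = j.castSucc then M a j.succ
      else if c = j.succ then M a j.castSucc + x * M a j.succ else M a c := by
  have hj := castSucc_ne_succ j
  rw [crossMatrix, ← Matrix.mul_assoc]
  split_ifs with h h'
  · rw [h, mul_transvection_apply_of_ne _ _ _ _ hj, mul_swap_apply_left]
  · rw [h', mul_transvection_apply_same, mul_swap_apply_right, mul_swap_apply_left]
  · rw [mul_transvection_apply_of_ne _ _ _ _ h', mul_swap_of_ne h h']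

/-- The product of the matrices `crossMatrix j x` over the letters `(j, x)` of a word. -/
def wordMatrix (L : List (Fin n × R)) : Matrix (Fin (n + 1)) (Fin (n + 1)) R :=
  (L.map fun p => crossMatrix p.1 p.2).prod

@[simp]
theorem wordMatrix_nil : wordMatrix ([] : List (Fin n × R)) = 1 := rfl

@[simp]
theorem wordMatrix_cons (p : Fin n × R) (L : List (Fin n × R)) :
    wordMatrix (p :: L) = crossMatrix p.1 p.2 * wordMatrix L := by
  simp only [wordMatrix, List.map_cons, List.prod_cons]

theorem wordMatrix_append (L L' : List (Fin n × R)) :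
    wordMatrix (L ++ L') = wordMatrix L * wordMatrix L' := by
  simp only [wordMatrix, List.map_append, List.prod_append]

theorem map_wordMatrix (φ : R →+* S) (L : List (Fin n × R)) :
    (wordMatrix L).map φ = wordMatrix (L.map fun p => (p.1, φ p.2)) := by
  induction L with
  | nil => simp
  | cons p L ih => simp [Matrix.map_mul, ih, map_crossMatrix]

/-- Lower triangular matrices with ones on the diagonal. -/
def IsLowerUnipotent (u : Matrix (Fin n) (Fin n) R) : Prop :=
  u.IsLowerTriangular ∧ ∀ a, u a a = 1

theorem IsLowerUnipotent.map {u : Matrix (Fin n) (Fin n) R} (hu : IsLowerUnipotent u)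
    (φ : R →+* S) : IsLowerUnipotent (u.map φ) :=
  ⟨hu.1.map φ, fun a => by rw [map_apply, hu.2, map_one]⟩

theorem IsLowerUnipotent.isUnit_det {u : Matrix (Fin n) (Fin n) R} (hu : IsLowerUnipotent u) :
    IsUnit u.det := by
  simp [det_of_isLowerTriangular u hu.1, hu.2]

theorem isLowerUnipotent_transvection {a b : Fin n} (h : b < a) (x : R) :
    IsLowerUnipotent (transvection a b x) := by
  refine ⟨blockTriangular_transvection (b := OrderDual.toDual)
    (OrderDual.toDual_le_toDual.2 h.le) x, fun c => ?_⟩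
  rw [transvection, Matrix.add_apply, one_apply_eq, single_apply_of_ne _ _ _ _ _ ?_, add_zero]
  rintro ⟨rfl, rfl⟩
  exact h.false

theorem IsLowerUnipotent.exists_mul_crossMatrix {u : Matrix (Fin (n + 1)) (Fin (n + 1)) R}
    (hu : IsLowerUnipotent u) (j : Fin n) (x : R) :
    ∃ u', IsLowerUnipotent u' ∧
      u * crossMatrix j x = crossMatrix j (x + u j.succ j.castSucc) * u' := by
  have hj : j.castSucc < j.succ := Fin.castSucc_lt_succ
  have hadj : ∀ b : Fin (n + 1), j.castSucc < b ↔ j.succ ≤ b := fun b =>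
    Fin.castSucc_lt_iff_succ_le
  have h0 : ∀ a c, a < c → u a c = 0 := fun a c hac => hu.1 (OrderDual.toDual_lt_toDual.2 hac)
  have h1 := hu.2
  set v := u * crossMatrix j x with hv
  set y := x + u j.succ j.castSucc
  refine ⟨of fun a c => if a = j.castSucc then v j.succ c - y * v j.castSucc c
    else if a = j.succ then v j.castSucc c else v a c, ⟨fun a c hac => ?_, fun a => ?_⟩, ?_⟩
  · have hac : a < c := OrderDual.toDual_lt_toDual.1 hac
    simp only [hv, of_apply, mul_crossMatrix_apply]
    split_ifs <;> grind
  · simp only [hv, of_apply, mul_crossMatrix_apply]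
    split_ifs <;> grind
  · ext a c
    simp only [crossMatrix_mul_apply, of_apply]
    split_ifs <;> grind

/-- For `R = K[t]` and the evaluation `φ` at `0`, the new coordinates form a curve through the old
ones. -/
theorem IsLowerUnipotent.exists_mul_wordMatrix (φ : R →+* S) {l : ℕ} (q : Fin l → Fin n)
    (z : Fin l → R) {u : Matrix (Fin (n + 1)) (Fin (n + 1)) R} (hu : IsLowerUnipotent u)
    (hφ : u.map φ = 1) :
    ∃ (z' : Fin l → R) (u' : Matrix (Fin (n + 1)) (Fin (n + 1)) R),
      IsLowerUnipotent u' ∧ (∀ i, φ (z' i) = φ (z i)) ∧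
      u * wordMatrix (List.ofFn fun i => (q i, z i)) =
        wordMatrix (List.ofFn fun i => (q i, z' i)) * u' := by
  induction l generalizing u with
  | zero => exact ⟨z, u, hu, fun _ => rfl, by simp⟩
  | succ l ih =>
    obtain ⟨v, hv, huv⟩ := hu.exists_mul_crossMatrix (q 0) (z 0)
    set y : R := z 0 + u (q 0).succ (q 0).castSucc with hy
    have hφy : φ y = φ (z 0) := by
      have := congrFun (congrFun hφ (q 0).succ) (q 0).castSucc
      rw [map_apply, one_apply_ne (castSucc_ne_succ _).symm] at this
      rw [hy, map_add, this, add_zero]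
    have hφv : v.map φ = 1 := by
      have := congrArg (fun A => A.map φ) huv
      simp only [Matrix.map_mul, hφ, one_mul, map_crossMatrix, hφy] at this
      exact (isUnit_crossMatrix _ _).mul_left_cancel (by rw [← this, mul_one])
    obtain ⟨z', u', hu', hz', h⟩ := ih (fun i => q i.succ) (fun i => z i.succ) hv hφv
    refine ⟨Fin.cons y z', u', hu', Fin.cases (by simpa using hφy) (by simpa using hz'), ?_⟩
    simp only [List.ofFn_succ, wordMatrix_cons, Fin.cons_zero, Fin.cons_succ]
    rw [← mul_assoc, huv, mul_assoc, h, mul_assoc]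

end CrossMatrix

section InCell

open Matrix

variable {R : Type*} [CommRing R] {n : ℕ} {σ : Equiv.Perm (Fin (n + 1))} {j : Fin n}
  {M : Matrix (Fin (n + 1)) (Fin (n + 1)) R}

/-- The opposite Bruhat cell of `σ`: the products of an invertible upper triangular matrix, the
permutation matrix of `σ`, and a lower triangular matrix. The last factor may be singular. -/
def InCell (σ : Equiv.Perm (Fin (n + 1))) (M : Matrix (Fin (n + 1)) (Fin (n + 1)) R) : Prop :=
  ∃ U L : Matrix (Fin (n + 1)) (Fin (n + 1)) R, U.IsUpperTriangular ∧ IsUnit U.det ∧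
    L.IsLowerTriangular ∧ M = U * L.submatrix σ id

theorem InCell.one : InCell 1 (1 : Matrix (Fin (n + 1)) (Fin (n + 1)) R) :=
  ⟨1, 1, blockTriangular_one, by simp, blockTriangular_one, by simp⟩

theorem InCell.mul_left {V : Matrix (Fin (n + 1)) (Fin (n + 1)) R} (h : InCell σ M)
    (hV : V.IsUpperTriangular) (hV' : IsUnit V.det) : InCell σ (V * M) := by
  obtain ⟨U, L, hU, hU', hL, rfl⟩ := h
  exact ⟨V * U, L, hV.mul hU, by rw [det_mul]; exact hV'.mul hU', hL, (mul_assoc _ _ _).symm⟩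

theorem InCell.mul_right {V : Matrix (Fin (n + 1)) (Fin (n + 1)) R} (h : InCell σ M)
    (hV : V.IsLowerTriangular) : InCell σ (M * V) := by
  obtain ⟨U, L, hU, hU', hL, rfl⟩ := h
  exact ⟨U, L * V, hU, hU', hL.mul hV, by rw [mul_assoc]; rfl⟩

theorem isUpperTriangular_crossMatrix_mul_mul_swap {U : Matrix (Fin (n + 1)) (Fin (n + 1)) R}
    (hU : U.IsUpperTriangular) {x : R}
    (hx : U j.castSucc j.succ + x * U j.succ j.succ = 0) :
    (crossMatrix j x * U * Matrix.swap R j.castSucc j.succ).IsUpperTriangular := by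
  have hj : j.castSucc < j.succ := Fin.castSucc_lt_succ
  have hadj : ∀ b : Fin (n + 1), b < j.succ ↔ b ≤ j.castSucc := fun b => by
    simp [Fin.lt_def, Fin.le_def]
  have hU0 : ∀ a c, c < a → U a c = 0 := fun a c h => hU h
  intro a c (hac : c < a)
  by_cases hc : c = j.castSucc
  · subst hc
    rw [mul_swap_apply_left, crossMatrix_mul_apply]
    split_ifs <;> grind
  by_cases hc' : c = j.succ
  · subst hc'
    rw [mul_swap_apply_right, crossMatrix_mul_apply]
    split_ifs <;> grind
  rw [mul_swap_of_ne hc hc', crossMatrix_mul_apply]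
  split_ifs <;> grind

theorem isUpperTriangular_crossMatrix_mul_mul_transvection
    {U : Matrix (Fin (n + 1)) (Fin (n + 1)) R} (hU : U.IsUpperTriangular) {x y : R}
    (hxy : U j.castSucc j.castSucc + y * (U j.castSucc j.succ + x * U j.succ j.succ) = 0) :
    (crossMatrix j x * U * transvection j.succ j.castSucc y).IsUpperTriangular := by
  have hj : j.castSucc < j.succ := Fin.castSucc_lt_succ
  have hadj : ∀ b : Fin (n + 1), b < j.succ ↔ b ≤ j.castSucc := fun b => by
    simp [Fin.lt_def, Fin.le_def]
  have hU0 : ∀ a c, c < a → U a c = 0 := fun a c h => hU h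
  intro a c (hac : c < a)
  by_cases hc : c = j.castSucc
  · subst hc
    rw [mul_transvection_apply_same, crossMatrix_mul_apply, crossMatrix_mul_apply]
    split_ifs <;> grind
  · rw [mul_transvection_apply_of_ne _ _ _ _ hc, crossMatrix_mul_apply]
    split_ifs <;> grind

theorem isUnit_det_crossMatrix_mul_mul {U V : Matrix (Fin (n + 1)) (Fin (n + 1)) R} (x : R)
    (hU : IsUnit U.det) (hV : IsUnit V.det) : IsUnit (crossMatrix j x * U * V).det := by
  rw [det_mul, det_mul]
  exact (((isUnit_iff_isUnit_det _).1 (isUnit_crossMatrix j x)).mul hU).mul hV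

theorem isUnit_apply_self_of_isUpperTriangular {U : Matrix (Fin n) (Fin n) R}
    (hU : U.IsUpperTriangular) (hU' : IsUnit U.det) (a : Fin n) : IsUnit (U a a) := by
  rw [det_of_isUpperTriangular hU] at hU'
  exact IsUnit.prod_iff.1 hU' a (Finset.mem_univ a)

theorem InCell.exists_crossMatrix_mul_of_swap
    (h : InCell (σ * Equiv.swap j.castSucc j.succ) M) :
    ∃ x : R, InCell σ (crossMatrix j x * M) := by
  obtain ⟨U, L, hU, hU', hL, rfl⟩ := h
  obtain ⟨d, hd⟩ := (isUnit_apply_self_of_isUpperTriangular hU hU' j.succ).exists_left_inv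
  have hL' : L.submatrix (σ * Equiv.swap j.castSucc j.succ) id =
      Matrix.swap R j.castSucc j.succ * L.submatrix σ id :=
    (PEquiv.toMatrix_toPEquiv_mul (Equiv.swap j.castSucc j.succ) (L.submatrix σ id)).symm
  obtain ⟨x, hx⟩ : ∃ x, U j.castSucc j.succ + x * U j.succ j.succ = 0 :=
    ⟨-U j.castSucc j.succ * d, by rw [mul_assoc, hd, mul_one, add_neg_cancel]⟩
  refine ⟨x, _, L, isUpperTriangular_crossMatrix_mul_mul_swap hU hx,
    isUnit_det_crossMatrix_mul_mul _ hU' (isUnit_det_of_left_inverse (swap_mul_self _ _)), hL, ?_⟩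
  rw [hL']
  simp only [mul_assoc]

theorem InCell.exists_crossMatrix_mul_of_lt (h : InCell σ M)
    (hσ : σ j.castSucc < σ j.succ) : ∃ x : R, InCell σ (crossMatrix j x * M) := by
  have hj : j.castSucc < j.succ := Fin.castSucc_lt_succ
  obtain ⟨U, L, hU, hU', hL, rfl⟩ := h
  obtain ⟨d, hd⟩ := (isUnit_apply_self_of_isUpperTriangular hU hU' j.succ).exists_left_inv
  set s := U j.castSucc j.castSucc with hs
  have hL' : (transvection (σ j.succ) (σ j.castSucc) s * L).submatrix σ id =
      transvection j.succ j.castSucc s * L.submatrix σ id := by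
    ext a c
    by_cases ha : a = j.succ
    · subst ha
      simp [transvection_mul_apply_same]
    · rw [transvection_mul_apply_of_ne _ _ _ _ ha, submatrix_apply,
        transvection_mul_apply_of_ne _ _ _ _ (fun h => ha (σ.injective h)), submatrix_apply]
  obtain ⟨x, hx⟩ : ∃ x, U j.castSucc j.succ + x * U j.succ j.succ = 1 :=
    ⟨(1 - U j.castSucc j.succ) * d, by rw [mul_assoc, hd, mul_one, add_sub_cancel]⟩
  refine ⟨x, _, transvection (σ j.succ) (σ j.castSucc) s * L,
    isUpperTriangular_crossMatrix_mul_mul_transvection hU (x := x) (y := -s) ?_,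
    isUnit_det_crossMatrix_mul_mul _ hU' (isLowerUnipotent_transvection hj _).isUnit_det,
    (isLowerUnipotent_transvection hσ s).1.mul hL, ?_⟩
  · rw [hx, mul_one, hs, add_neg_cancel]
  · simp only [hL', mul_assoc]
    rw [← mul_assoc (transvection _ _ (-s)), transvection_mul_transvection_same _ _ hj.ne',
      neg_add_cancel, transvection_zero, one_mul]

/-- One step of sorting: the entries at `j, j + 1` are put into increasing order, unless
the comparison is skipped. -/
def sortStep (σ : Equiv.Perm (Fin (n + 1))) (p : Fin n × Bool) : Equiv.Perm (Fin (n + 1)) :=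
  if p.2 = false ∧ σ p.1.succ < σ p.1.castSucc then σ * Equiv.swap p.1.castSucc p.1.succ else σ

theorem InCell.exists_crossMatrix_mul (h : InCell (sortStep σ (j, false)) M) :
    ∃ x : R, InCell σ (crossMatrix j x * M) := by
  by_cases hσ : σ j.succ < σ j.castSucc
  · rw [sortStep, if_pos ⟨rfl, hσ⟩] at h
    exact h.exists_crossMatrix_mul_of_swap
  · rw [sortStep, if_neg (hσ ·.2)] at h
    exact h.exists_crossMatrix_mul_of_lt ((not_lt.1 hσ).lt_of_ne
      (σ.injective.ne (castSucc_ne_succ j)))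

/-- A point of a cell is the limit of points of the cell of a longer word, for which the new
coordinate tends to infinity. -/
theorem InCell.exists_curve {K : Type*} [Field K] (j : Fin n)
    {l : ℕ} (q : Fin l → Fin n) (z : Fin l → K)
    (h : InCell σ (wordMatrix (List.ofFn fun i => (q i, z i)))) :
    ∃ p : Fin l → Polynomial K, (∀ i, (p i).eval 0 = z i) ∧ ∀ t : K, t ≠ 0 →
      InCell σ (wordMatrix ((j, t⁻¹) :: List.ofFn fun i => (q i, (p i).eval t))) := by
  have hj : j.castSucc < j.succ := Fin.castSucc_lt_succ
  obtain ⟨p, u, hu, hp, hw⟩ :=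
    (isLowerUnipotent_transvection hj (-Polynomial.X)).exists_mul_wordMatrix
      (Polynomial.evalRingHom (0 : K)) q (fun i => Polynomial.C (z i))
      (by rw [map_transvection]; simp)
  refine ⟨p, fun i => by simpa using hp i, fun t ht => ?_⟩
  set W := wordMatrix (List.ofFn fun i => (q i, (p i).eval t))
  set v := u.map (Polynomial.evalRingHom t)
  have hv : IsLowerUnipotent v := hu.map _
  have hWv : transvection j.succ j.castSucc (-t) * wordMatrix (List.ofFn fun i => (q i, z i)) =
      W * v := by
    have := congrArg (fun A => A.map (Polynomial.evalRingHom t)) hw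
    simp only [Matrix.map_mul, map_wordMatrix, map_transvection] at this
    simpa [W, v, List.map_ofFn, Function.comp_def] using this
  have : Invertible v := v.invertibleOfIsUnitDet hv.isUnit_det
  have hvinv : v⁻¹.IsLowerTriangular := blockTriangular_inv_of_blockTriangular hv.1
  have hWeq : W = transvection j.succ j.castSucc (-t) *
      (wordMatrix (List.ofFn fun i => (q i, z i)) * v⁻¹) := by
    rw [← mul_assoc, hWv, mul_nonsing_inv_cancel_right _ _ hv.isUnit_det]
  rw [wordMatrix_cons]
  change InCell σ (crossMatrix j t⁻¹ * W)
  rw [hWeq, ← mul_assoc, ← mul_one (crossMatrix j t⁻¹)]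
  refine (h.mul_right hvinv).mul_left
    (isUpperTriangular_crossMatrix_mul_mul_transvection blockTriangular_one ?_)
    (isUnit_det_crossMatrix_mul_mul _ (by simp) (isLowerUnipotent_transvection hj _).isUnit_det)
  simp [one_apply_ne (castSucc_ne_succ j), ht]

end InCell

section Independence

variable {K : Type*} [Field K] [Infinite K] {n l : ℕ}

theorem eval_leadingCoeff_finSuccEquiv_eq_zero_of_curve (F : MvPolynomial (Fin (l + 1)) K)
    (p : Fin l → Polynomial K)
    (h : ∀ t : K, t ≠ 0 → MvPolynomial.eval (Fin.cons t⁻¹ fun i => (p i).eval t) F = 0) :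
    MvPolynomial.eval (fun i => (p i).eval 0)
      (MvPolynomial.finSuccEquiv K l F).leadingCoeff = 0 := by
  set G := MvPolynomial.finSuccEquiv K l F with hG
  have heval : ∀ t, (Polynomial.evalRingHom t).comp (MvPolynomial.aeval p).toRingHom =
      MvPolynomial.eval fun i => (p i).eval t := fun t => by ext <;> simp
  set H : Polynomial K :=
    G.reverse.eval₂ (MvPolynomial.aeval p).toRingHom Polynomial.X with hH
  have hHt : ∀ t, H.eval t =
      G.reverse.eval₂ (MvPolynomial.eval fun i => (p i).eval t) t := fun t => by
    rw [← heval, hH, ← Polynomial.coe_evalRingHom, Polynomial.hom_eval₂,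
      Polynomial.coe_evalRingHom, Polynomial.eval_X]
  have hH0 : H = 0 := by
    refine Polynomial.eq_zero_of_infinite_isRoot H
      ((Set.finite_singleton (0 : K)).infinite_compl.mono fun t (ht : t ≠ 0) => ?_)
    have hG0 := h t ht
    rw [MvPolynomial.eval_eq_eval_mv_eval', ← hG, Polynomial.eval_map] at hG0
    let : Invertible t⁻¹ := invertibleOfNonzero (inv_ne_zero ht)
    have := (Polynomial.eval₂_reverse_eq_zero_iff _ t⁻¹ G).2 hG0
    rwa [invOf_eq_inv, inv_inv, ← hHt] at this
  rw [← Polynomial.coeff_zero_reverse, ← Polynomial.eval₂_at_zero, ← hHt, hH0, Polynomial.eval_zero]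

/-- The skipped comparisons are those at the variables of a monomial of `F`. It is the leading
coefficient with respect to the first variable that vanishes on a cell of the shorter word: if the
variable does not occur, then a value for it can be found, and otherwise it tends to infinity along
the curve of `InCell.exists_curve`. -/
theorem eq_zero_of_vanishes_on_cell (q : Fin l → Fin n)
    (σ : Equiv.Perm (Fin (n + 1))) (F : MvPolynomial (Fin l) K)
    (hF : ∀ m ∈ F.support, (List.ofFn fun i => (q i, m i != 0)).foldl sortStep σ = 1)
    (hv : ∀ z : Fin l → K, InCell σ (wordMatrix (List.ofFn fun i => (q i, z i))) →
      MvPolynomial.eval z F = 0) : F = 0 := by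
  induction l generalizing σ with
  | zero =>
    by_contra hne
    obtain ⟨m, hm⟩ := MvPolynomial.support_nonempty.2 hne
    have hσ : σ = 1 := by simpa using hF m hm
    have h0 := hv 0 (by simpa [hσ] using InCell.one)
    rw [MvPolynomial.eq_C_of_isEmpty F, MvPolynomial.eval_C] at h0
    exact hne (by rw [MvPolynomial.eq_C_of_isEmpty F, h0, MvPolynomial.C_0])
  | succ l ih =>
    set G := MvPolynomial.finSuccEquiv K l F with hG
    suffices hlead : G.leadingCoeff = 0 by simpa [hG] using hlead
    have hsupp : ∀ m ∈ G.leadingCoeff.support,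
        (List.ofFn fun i => (q i.succ, m i != 0)).foldl sortStep
          (sortStep σ (q 0, G.natDegree != 0)) = 1 := fun m hm => by
      simpa [List.ofFn_succ] using hF _ (MvPolynomial.mem_support_coeff_finSuccEquiv.1 hm)
    by_cases hdeg : G.natDegree = 0
    · refine ih _ _ _ hsupp fun z hz => ?_
      obtain ⟨x, hx⟩ : ∃ x, InCell σ (crossMatrix (q 0) x *
          wordMatrix (List.ofFn fun i => (q i.succ, z i))) :=
        InCell.exists_crossMatrix_mul (by simpa [hdeg] using hz)
      have hF0 := hv (Fin.cons x z) (by simpa [List.ofFn_succ] using hx)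
      rw [MvPolynomial.eval_eq_eval_mv_eval', ← hG,
        Polynomial.eq_C_of_natDegree_eq_zero hdeg] at hF0
      simpa [Polynomial.leadingCoeff, hdeg] using hF0
    · refine ih _ _ _ hsupp fun z hz => ?_
      rw [sortStep, if_neg (by simp [hdeg])] at hz
      obtain ⟨p, hp, hcurve⟩ := hz.exists_curve (q 0)
      obtain rfl : (fun i => (p i).eval 0) = z := funext hp
      exact eval_leadingCoeff_finSuccEquiv_eq_zero_of_curve F p fun t ht =>
        hv _ (by simpa [List.ofFn_succ] using hcurve t ht)

theorem map_prodMap_id_eq_ofFn {A B C : Type*} (Q : List (A × B)) (x : B → C) :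
    Q.map (Prod.map id x) = List.ofFn fun i : Fin Q.length => (Q[i].1, x Q[i].2) := by
  conv_lhs => rw [← List.ofFn_getElem (xs := Q), List.map_ofFn]
  rfl

theorem eq_zero_of_vanishes_on_cell_of_nodup {C : Type*} (Q : List (Fin n × C))
    (hQ : (Q.map Prod.snd).Nodup) (σ : Equiv.Perm (Fin (n + 1))) (F : MvPolynomial C K)
    (hFQ : ∀ c ∈ F.vars, c ∈ Q.map Prod.snd)
    (hF : ∀ m ∈ F.support, (Q.map (Prod.map id (m · != 0))).foldl sortStep σ = 1)
    (hv : ∀ x : C → K, InCell σ (wordMatrix (Q.map (Prod.map id x))) →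
      MvPolynomial.eval x F = 0) : F = 0 := by
  set label : Fin Q.length → C := fun i => Q[i].2
  have hinj : Function.Injective label := fun i j hij => by
    have := hQ.getElem_inj_iff (i := i) (j := j) (hi := by simp) (hj := by simp)
    exact Fin.ext (this.1 (by simpa [label] using hij))
  obtain ⟨F, rfl⟩ := MvPolynomial.exists_rename_eq_of_vars_subset_range F label hinj fun c hc => by
    obtain ⟨i, hi, h⟩ := List.getElem_of_mem (hFQ c hc)
    exact ⟨⟨i, by simpa using hi⟩, by simpa [label] using h⟩
  rw [eq_zero_of_vanishes_on_cell (fun i => Q[i].1) σ F, map_zero]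
  · intro m hm
    have := hF (m.mapDomain label) (by
      classical
      rw [MvPolynomial.support_rename_of_injective hinj]
      exact Finset.mem_image_of_mem _ hm)
    rw [map_prodMap_id_eq_ofFn] at this
    change (List.ofFn fun i => (Q[i].1, m.mapDomain label (label i) != 0)).foldl sortStep σ = 1
      at this
    simpa only [Finsupp.mapDomain_apply hinj] using this
  · intro z hz
    have hext : Function.extend label z 0 ∘ label = z := Function.extend_comp hinj z 0
    rw [← hext, ← MvPolynomial.eval_rename]
    rw [← hext] at hz
    exact hv _ (by rwa [map_prodMap_id_eq_ofFn])

end Independence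

/-! ### The staircase word -/

section StairWord

open Matrix

variable {R : Type*} [CommRing R] {n : ℕ}

theorem wordMatrix_map_castSucc_apply (L : List (Fin n × R)) (a b : Fin (n + 1)) :
    wordMatrix (L.map (Prod.map Fin.castSucc id)) a.castSucc b.castSucc = wordMatrix L a b := by
  induction L generalizing a with
  | nil => simp [one_apply]
  | cons p L ih => simp [crossMatrix_mul_apply, ← Fin.castSucc_succ, ih]

theorem wordMatrix_map_castSucc_apply_last (L : List (Fin n × R)) (a : Fin (n + 1)) :
    wordMatrix (L.map (Prod.map Fin.castSucc id)) a.castSucc (Fin.last _) = 0 := by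
  induction L generalizing a with
  | nil => simp [one_apply]
  | cons p L ih => simp [crossMatrix_mul_apply, ← Fin.castSucc_succ, ih]

theorem wordMatrix_map_castSucc_last_apply (L : List (Fin n × R)) (b : Fin (n + 2)) :
    wordMatrix (L.map (Prod.map Fin.castSucc id)) (Fin.last _) b =
      (1 : Matrix (Fin (n + 2)) (Fin (n + 2)) R) (Fin.last _) b := by
  induction L with
  | nil => simp
  | cons p L ih =>
    simp [crossMatrix_mul_apply, ← Fin.castSucc_succ, ih, (Fin.castSucc_ne_last _).symm]

/-- The positions `n - 1, …, 0` in this order, with the given labels. -/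
def columnWord {A : Type*} {n : ℕ} (z : Fin n → A) : List (Fin n × A) :=
  List.ofFn fun i => (i.rev, z i)

theorem columnWord_succ {A : Type*} (z : Fin (n + 1) → A) :
    columnWord z =
      (Fin.last n, z 0) :: (columnWord (Fin.tail z)).map (Prod.map Fin.castSucc id) := by
  simp [columnWord, List.ofFn_succ, Fin.rev_succ, List.map_ofFn, Function.comp_def, Fin.tail]

theorem mul_wordMatrix_map_castSucc_apply {m : Type*} (M : Matrix m (Fin (n + 2)) R)
    (L : List (Fin n × R)) (a : m) (b : Fin (n + 1)) :
    (M * wordMatrix (L.map (Prod.map Fin.castSucc id))) a b.castSucc =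
      (M.submatrix id Fin.castSucc * wordMatrix L) a b := by
  simp [Matrix.mul_apply, Fin.sum_univ_castSucc, wordMatrix_map_castSucc_apply,
    wordMatrix_map_castSucc_last_apply, one_apply, (Fin.castSucc_ne_last _).symm]

theorem mul_wordMatrix_map_castSucc_apply_last {m : Type*} (M : Matrix m (Fin (n + 2)) R)
    (L : List (Fin n × R)) (a : m) :
    (M * wordMatrix (L.map (Prod.map Fin.castSucc id))) a (Fin.last _) = M a (Fin.last _) := by
  simp [Matrix.mul_apply, Fin.sum_univ_castSucc, wordMatrix_map_castSucc_apply_last,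
    wordMatrix_map_castSucc_last_apply]

theorem mul_wordMatrix_columnWord_apply_succ {m : Type*} (M : Matrix m (Fin (n + 1)) R)
    (z : Fin n → R) (a : m) (c : Fin n) : (M * wordMatrix (columnWord z)) a c.succ =
      M a c.castSucc + z c.rev * M a (Fin.last n) := by
  induction n with
  | zero => exact c.elim0
  | succ n ih =>
    rw [columnWord_succ, wordMatrix_cons, ← Matrix.mul_assoc]
    induction c using Fin.lastCases with
    | last =>
      rw [Fin.succ_last, mul_wordMatrix_map_castSucc_apply_last]
      simp [mul_crossMatrix_apply, (Fin.castSucc_ne_last _).symm]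
    | cast c =>
      rw [Fin.succ_castSucc, mul_wordMatrix_map_castSucc_apply, ih]
      simp [mul_crossMatrix_apply, Fin.tail, Fin.rev_castSucc]

/-- The word of the staircase with the cells `(α, β)`, `α < β ≤ n`, column by column, where the cell
`(α, β)` has the position `β - 1 - α`. -/
def stairWord : (n : ℕ) → List (Fin n × ℕ × ℕ)
  | 0 => []
  | n + 1 => (stairWord n).map (Prod.map Fin.castSucc id) ++
      columnWord fun i : Fin (n + 1) => ((i : ℕ), n + 1)

theorem map_stairWord_succ {A : Type*} (z : ℕ × ℕ → A) (n : ℕ) :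
    (stairWord (n + 1)).map (Prod.map id z) =
      ((stairWord n).map (Prod.map id z)).map (Prod.map Fin.castSucc id) ++
        columnWord fun i : Fin (n + 1) => z (i, n + 1) := by
  simp [stairWord, columnWord, List.map_ofFn, Function.comp_def]

theorem map_snd_stairWord_succ (n : ℕ) : (stairWord (n + 1)).map Prod.snd =
    (stairWord n).map Prod.snd ++ List.ofFn fun i : Fin (n + 1) => ((i : ℕ), n + 1) := by
  simp [stairWord, columnWord, List.map_ofFn, Function.comp_def]

theorem mem_map_snd_stairWord {c : ℕ × ℕ} :
    c ∈ (stairWord n).map Prod.snd ↔ c.1 < c.2 ∧ c.2 ≤ n := by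
  induction n with
  | zero =>
    simp only [stairWord, List.map_nil, List.not_mem_nil, false_iff]
    omega
  | succ n ih =>
    have hcol : (∃ i : Fin (n + 1), ((i : ℕ), n + 1) = c) ↔ c.1 < c.2 ∧ c.2 = n + 1 :=
      ⟨fun ⟨i, hi⟩ => hi ▸ ⟨i.2, rfl⟩, fun h => ⟨⟨c.1, h.2 ▸ h.1⟩, Prod.ext rfl h.2.symm⟩⟩
    rw [map_snd_stairWord_succ, List.mem_append, ih, List.mem_ofFn', Set.mem_range, hcol]
    omega

theorem nodup_map_snd_stairWord (n : ℕ) : ((stairWord n).map Prod.snd).Nodup := by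
  induction n with
  | zero => exact List.nodup_nil
  | succ n ih =>
    rw [map_snd_stairWord_succ, List.nodup_append']
    refine ⟨ih, List.nodup_ofFn_ofInjective fun i j h => Fin.ext (congrArg Prod.fst h), ?_⟩
    intro c hc hc'
    obtain ⟨i, rfl⟩ := List.mem_ofFn.1 hc'
    exact absurd (mem_map_snd_stairWord.1 hc).2 (Nat.not_succ_le_self n)

theorem wordMatrix_stairWord_apply (z : ℕ × ℕ → R) {a c : Fin (n + 1)} (h : n < a + c) :
    wordMatrix ((stairWord n).map (Prod.map id z)) a c = z (n - c, a) := by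
  induction n with
  | zero => omega
  | succ n ih =>
    have hc : c ≠ 0 := by rintro rfl; exact h.not_ge (Nat.lt_succ_iff.1 a.2)
    obtain ⟨c, rfl⟩ := Fin.exists_succ_eq.2 hc
    rw [map_stairWord_succ, wordMatrix_append, mul_wordMatrix_columnWord_apply_succ]
    induction a using Fin.lastCases with
    | last =>
      rw [wordMatrix_map_castSucc_last_apply, wordMatrix_map_castSucc_last_apply]
      simp [(Fin.castSucc_ne_last _).symm]
    | cast a =>
      rw [wordMatrix_map_castSucc_apply, wordMatrix_map_castSucc_apply_last,
        ih (by simp only [Fin.val_castSucc, Fin.val_succ] at h; omega)]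
      simp

end StairWord

section MiddleReversal

open Matrix

variable {K : Type*} [Field K] {n r : ℕ}

theorem det_mul_eq_zero_of_card_lt {m ι : Type*} [Fintype m] [DecidableEq m] [Fintype ι]
    (A : Matrix m ι K) (B : Matrix ι m K) (s : Finset ι) (hs : s.card < Fintype.card m)
    (h : ∀ i j, ∀ x ∉ s, A i x * B x j = 0) : (A * B).det = 0 := by
  obtain ⟨A', hA'⟩ : ∃ A' : Matrix m s K, A' = A.submatrix id Subtype.val := ⟨_, rfl⟩
  obtain ⟨B', hB'⟩ : ∃ B' : Matrix s m K, B' = B.submatrix Subtype.val id := ⟨_, rfl⟩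
  have hfac : A * B = A' * B' := by
    ext i j
    rw [Matrix.mul_apply, Matrix.mul_apply, ← Finset.sum_subset s.subset_univ
      fun x _ hx => h i j x hx, ← Finset.sum_coe_sort, hA', hB']
    rfl
  by_contra hdet
  have hrank := rank_of_isUnit _ ((isUnit_iff_isUnit_det _).2 (isUnit_iff_ne_zero.2 hdet))
  have hle := (rank_mul_le_left A' B').trans (rank_le_card_width _)
  rw [← hfac, hrank, Fintype.card_coe] at hle
  omega

/-- The permutation that fixes the first and the last `r - 1` elements and reverses the
other ones. -/
def middleRev (n r : ℕ) : Equiv.Perm (Fin (n + 1)) :=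
  Function.Involutive.toPerm
    (fun x => if r ≤ (x : ℕ) + 1 ∧ (x : ℕ) + r ≤ n + 1 then Fin.rev x else x) (by
      intro x
      grind [Fin.rev_rev])

theorem middleRev_val (n r : ℕ) (x : Fin (n + 1)) : (middleRev n r x : ℕ) =
    if r ≤ (x : ℕ) + 1 ∧ (x : ℕ) + r ≤ n + 1 then n - x else x := by
  change ((if r ≤ (x : ℕ) + 1 ∧ (x : ℕ) + r ≤ n + 1 then Fin.rev x else x : Fin (n + 1)) : ℕ) = _
  grind

/-- Only the last `r - 1` columns of the upper triangular factor contribute to a minor below the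
antidiagonal. -/
theorem InCell.det_submatrix_eq_zero (hr : 1 ≤ r) (hn : 2 * r ≤ n + 1)
    {M : Matrix (Fin (n + 1)) (Fin (n + 1)) K} (h : InCell (middleRev n r) M)
    (f g : Fin r → Fin (n + 1)) (hfg : ∀ i j, n < (f i : ℕ) + g j) :
    (M.submatrix f g).det = 0 := by
  obtain ⟨U, L, hU, -, hL, rfl⟩ := h
  have hcard : (Finset.Ioi (⟨n + 1 - r, by omega⟩ : Fin (n + 1))).card < Fintype.card (Fin r) := by
    rw [Fin.card_Ioi, Fintype.card_fin]
    simp only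
    omega
  refine det_mul_eq_zero_of_card_lt (U.submatrix f id)
    ((L.submatrix (middleRev n r) id).submatrix id g) _ hcard fun i j x hx => ?_
  rcases lt_or_ge x (f i) with hlt | hle
  · exact mul_eq_zero_of_left (hU hlt) _
  · refine mul_eq_zero_of_right _ (hL (?_ : middleRev n r x < g j))
    rw [Finset.mem_Ioi, Fin.lt_def, not_lt] at hx
    rw [Fin.lt_def, middleRev_val]
    have := hfg i j
    grind [Fin.le_def]

end MiddleReversal

section Sorting

open Finset

theorem exists_apply_lt_of_ne_one {α : Type*} [LinearOrder α] [Finite α] {σ : Equiv.Perm α}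
    (hσ : σ ≠ 1) : ∃ i, σ i < i ∧ ∀ j, i < j → σ j = j := by
  obtain ⟨i₀, hi₀⟩ : ∃ i, σ i ≠ i := by
    by_contra! h
    exact hσ (Equiv.ext h)
  obtain ⟨i, hi, hmax⟩ := (Set.toFinite {i | σ i ≠ i}).exists_maximal ⟨i₀, hi₀⟩
  have hfix : ∀ j, i < j → σ j = j := fun j hj => by
    by_contra h
    exact hj.not_ge (hmax h hj.le)
  exact ⟨i, (lt_or_gt_of_ne hi).resolve_right fun h => hi (σ.injective (hfix _ h)), hfix⟩

variable {n : ℕ}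

/-- The number of values at least `θ` among the first `p` entries of a permutation. -/
def excess (σ : Equiv.Perm (Fin (n + 1))) (θ p : ℕ) : ℕ :=
  #{x : Fin (n + 1) | x < p ∧ θ ≤ σ x}

theorem eq_one_of_excess_self_eq_zero {σ : Equiv.Perm (Fin (n + 1))}
    (h : ∀ θ, excess σ θ θ = 0) : σ = 1 := by
  have hle : ∀ x, σ x ≤ x := fun x => by
    have := filter_eq_empty_iff.1 (card_eq_zero.1 (h (x + 1))) (mem_univ x)
    rw [Fin.le_def]
    omega
  by_contra hσ
  obtain ⟨i, hi, -⟩ := exists_apply_lt_of_ne_one (inv_ne_one.2 hσ)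
  exact (hle (σ⁻¹ i)).not_gt (by simpa using hi)

theorem excess_succ (σ : Equiv.Perm (Fin (n + 1))) (θ : ℕ) (x : Fin (n + 1)) :
    excess σ θ (x + 1) = excess σ θ x + if θ ≤ σ x then 1 else 0 := by
  have hset : (univ.filter fun y : Fin (n + 1) => (y : ℕ) < x + 1) =
      insert x (univ.filter fun y : Fin (n + 1) => (y : ℕ) < x) := by
    ext y
    simp only [mem_filter_univ, mem_insert, Fin.ext_iff]
    omega
  rw [excess, excess, ← filter_filter, ← filter_filter, hset, filter_insert]
  split_ifs
  · rw [card_insert_of_notMem (by simp)]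
  · rfl

theorem excess_mul_swap (σ : Equiv.Perm (Fin (n + 1))) (θ : ℕ) (j : Fin n) {p : ℕ}
    (hp : p ≠ j + 1) :
    excess (σ * Equiv.swap j.castSucc j.succ) θ p = excess σ θ p := by
  refine card_equiv (Equiv.swap j.castSucc j.succ) fun x => ?_
  rw [mem_filter_univ, mem_filter_univ, Equiv.Perm.mul_apply]
  refine and_congr_left fun _ => ?_
  rw [Equiv.swap_apply_def]
  grind

/-- The effect of a sorting step on the function `excess σ θ`. -/
def excessStep (h : ℕ → ℕ) (p : Fin n × Bool) : ℕ → ℕ :=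
  if p.2 = false then Function.update h (p.1 + 1) (max (h p.1) (h (p.1 + 2) - 1)) else h

theorem excess_sortStep (σ : Equiv.Perm (Fin (n + 1))) (θ : ℕ) (p : Fin n × Bool) :
    excess (sortStep σ p) θ = excessStep (excess σ θ) p := by
  obtain ⟨j, b⟩ := p
  have hj : ∀ τ : Equiv.Perm (Fin (n + 1)), excess τ θ (j + 1) =
      excess τ θ j + if θ ≤ τ j.castSucc then 1 else 0 := fun τ => excess_succ τ θ j.castSucc
  have hj' : excess σ θ (j + 2) = excess σ θ (j + 1) + if θ ≤ σ j.succ then 1 else 0 :=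
    excess_succ σ θ j.succ
  funext p
  rw [sortStep, excessStep]
  by_cases hp : p = j + 1
  · subst hp
    have : (σ j.castSucc : ℕ) ≠ σ j.succ :=
      fun h => castSucc_ne_succ j (σ.injective (Fin.ext h))
    have := hj σ
    have := hj (σ * Equiv.swap j.castSucc j.succ)
    have := excess_mul_swap σ θ j (p := j) (by omega)
    simp only [Equiv.Perm.mul_apply, Equiv.swap_apply_left, Fin.lt_def] at *
    grind
  · split_ifs with h h' h' <;> simp_all [excess_mul_swap]

theorem excess_foldl_sortStep (L : List (Fin n × Bool)) (σ : Equiv.Perm (Fin (n + 1))) (θ : ℕ) :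
    excess (L.foldl sortStep σ) θ = L.foldl excessStep (excess σ θ) := by
  induction L generalizing σ with
  | nil => rfl
  | cons p _ ih => rw [List.foldl_cons, ih, excess_sortStep, List.foldl_cons]

theorem foldl_excessStep_le {s : ℕ} (L : List (Fin n × Bool)) {h : ℕ → ℕ}
    (hs : ∀ p, h p ≤ p - s) (p : ℕ) : L.foldl excessStep h p ≤ p - s := by
  induction L generalizing h with
  | nil => exact hs p
  | cons q _ ih =>
    refine ih fun p => ?_
    have h1 := hs q.1
    have h2 := hs (q.1 + 2)
    have h3 := hs p
    rw [excessStep]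
    grind [Function.update_apply]

theorem foldl_excessStep_of_lt (L : List (Fin n × Bool)) (h : ℕ → ℕ) {p : ℕ} (hp : n < p) :
    L.foldl excessStep h p = h p := by
  induction L generalizing h with
  | nil => rfl
  | cons q L ih =>
    rw [List.foldl_cons, ih, excessStep]
    grind [Function.update_apply]

theorem foldl_excessStep_map_castSucc (L : List (Fin n × Bool)) (h : ℕ → ℕ) :
    (L.map (Prod.map Fin.castSucc id)).foldl excessStep h = L.foldl excessStep h :=
  List.foldl_map

theorem foldl_excessStep_columnWord (b : Fin n → Bool) (h : ℕ → ℕ) (i : Fin n) :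
    (columnWord b).foldl excessStep h (i.rev + 1) =
      if b i = false then max (h i.rev) ((columnWord b).foldl excessStep h (i.rev + 2) - 1)
      else h (i.rev + 1) := by
  induction n generalizing h with
  | zero => exact i.elim0
  | succ n ih =>
    rw [columnWord_succ, List.foldl_cons, foldl_excessStep_map_castSucc]
    cases i using Fin.cases with
    | zero =>
      rw [foldl_excessStep_of_lt _ _ (by simp), foldl_excessStep_of_lt _ _ (by simp), excessStep]
      grind [Function.update_apply]
    | succ i =>
      rw [Fin.rev_succ, Fin.val_castSucc, ih, excessStep]
      grind [Function.update_apply, Fin.tail]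

end Sorting

section Chain

open Finset

variable {n r : ℕ}

theorem strictMono_snoc {α : Type*} [Preorder α] {t : ℕ} {f : Fin t → α} (hf : StrictMono f)
    {a : α} (ha : ∀ i, f i < a) : StrictMono (Fin.snoc f a : Fin (t + 1) → α) := by
  intro i j hij
  cases i using Fin.lastCases with
  | last => exact absurd hij (Fin.le_last j).not_gt
  | cast i =>
    cases j using Fin.lastCases with
    | last => simpa using ha i
    | cast j => simpa using hf hij

/-- The function obtained from `h` by sorting along the staircase word, where the comparisons at
the cells in `used` are skipped. -/
def stairExcess (used : ℕ × ℕ → Bool) (h : ℕ → ℕ) (n : ℕ) : ℕ → ℕ :=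
  ((stairWord n).map (Prod.map id used)).foldl excessStep h

theorem stairExcess_succ (used : ℕ × ℕ → Bool) (h : ℕ → ℕ) (n : ℕ) :
    stairExcess used h (n + 1) =
      (columnWord fun i : Fin (n + 1) => used (i, n + 1)).foldl excessStep
        (stairExcess used h n) := by
  rw [stairExcess, map_stairWord_succ, List.foldl_append, foldl_excessStep_map_castSucc,
    stairExcess]

theorem stairExcess_succ_apply (used : ℕ × ℕ → Bool) (h : ℕ → ℕ) {n a p : ℕ} (hp : a + p = n) :
    stairExcess used h (n + 1) (p + 1) =
      if used (a, n + 1) = false then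
        max (stairExcess used h n p) (stairExcess used h (n + 1) (p + 2) - 1)
      else stairExcess used h n (p + 1) := by
  have := foldl_excessStep_columnWord (fun i : Fin (n + 1) => used (i, n + 1))
    (stairExcess used h n) ⟨a, by omega⟩
  have hrev : (Fin.rev (⟨a, by omega⟩ : Fin (n + 1)) : ℕ) = p := by
    rw [Fin.val_rev]
    simp only
    omega
  rw [hrev] at this
  rw [stairExcess_succ, this]

/-- There are `t` used cells, strictly increasing in both coordinates, with first coordinates less
than `a` and second coordinates in the interval `(m, b]`. -/
def HasChain (used : ℕ × ℕ → Bool) (t a m b : ℕ) : Prop :=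
  ∃ f g : Fin t → ℕ, StrictMono f ∧ StrictMono g ∧ (∀ i, used (f i, g i) = true) ∧
    (∀ i, f i < a) ∧ ∀ i, m < g i ∧ g i ≤ b

theorem hasChain_zero (used : ℕ × ℕ → Bool) (a m b : ℕ) : HasChain used 0 a m b :=
  ⟨Fin.elim0, Fin.elim0, fun i => i.elim0, fun i => i.elim0, fun i => i.elim0, fun i => i.elim0,
    fun i => i.elim0⟩

theorem HasChain.mono {used : ℕ × ℕ → Bool} {t a a' m b b' : ℕ} (h : HasChain used t a m b)
    (ha : a ≤ a') (hb : b ≤ b') : HasChain used t a' m b' :=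
  let ⟨f, g, hf, hg, hfg, hfa, hgb⟩ := h
  ⟨f, g, hf, hg, hfg, fun i => (hfa i).trans_le ha, fun i => (hgb i).imp_right hb.trans'⟩

theorem HasChain.snoc {used : ℕ × ℕ → Bool} {t a m b : ℕ} (h : HasChain used t a m b)
    (hab : used (a, b + 1) = true) (hm : m ≤ b) : HasChain used (t + 1) (a + 1) m (b + 1) := by
  obtain ⟨f, g, hf, hg, hfg, hfa, hgb⟩ := h
  refine ⟨Fin.snoc f a, Fin.snoc g (b + 1), strictMono_snoc hf hfa,
    strictMono_snoc hg fun i => Nat.lt_succ_of_le (hgb i).2, ?_, ?_, ?_⟩ <;>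
    intro i <;> cases i using Fin.lastCases <;> grind [Fin.snoc_last, Fin.snoc_castSucc]

/-- A positive excess is traced back through the staircase word: at a used cell it comes from the
previous column, and at an unused one also from the neighbouring position of the same column, where
it is larger by one. The used cells that are passed form the chain. -/
theorem hasChain_of_le_stairExcess {used : ℕ × ℕ → Bool} {h : ℕ → ℕ} {θ m : ℕ}
    (hθ : θ + m = n) (hr : 1 ≤ r) (hlow : ∀ p, h p ≤ p - (r - 1))
    (hhigh : ∀ p, h p ≤ max p (n + 2 - r) - θ) {a b k t : ℕ}
    (hk0 : 0 < k) (hle : k ≤ stairExcess used h b (b + 1 - a)) (hb : b + r ≤ n + t)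
    (hk : t + m + 2 = r + a + k) : HasChain used t a m b := by
  rcases t with - | t
  · exact hasChain_zero used a m b
  have hlow' : ∀ b p, stairExcess used h b p ≤ p - (r - 1) := fun b =>
    foldl_excessStep_le _ hlow
  induction b generalizing a k t with
  | zero =>
    have hhigh1 := hhigh 1
    have hlow0 := hlow 0
    change k ≤ h (1 - a) at hle
    rcases a with - | a
    · rw [Nat.sub_zero] at hle
      omega
    · rw [show 1 - (a + 1) = 0 by omega] at hle
      omega
  | succ b ihb =>
    induction a generalizing k t with
    | zero =>
      have hhigh_b := hhigh (b + 1 + 1)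
      rw [Nat.sub_zero, stairExcess, foldl_excessStep_of_lt _ _ (by omega)] at hle
      omega
    | succ a iha =>
      have hlow_b := hlow' (b + 1) (b + 1 + 1 - (a + 1))
      obtain ⟨p, rfl⟩ : ∃ p, b = a + p := ⟨b - a, by omega⟩
      rw [show a + p + 1 + 1 - (a + 1) = p + 1 by omega] at hle
      rw [stairExcess_succ_apply used h rfl] at hle
      split_ifs at hle with hused
      · rcases le_max_iff.1 hle with hle | hle
        · exact (ihb (a := a + 1) hk0 (by rwa [show a + p + 1 - (a + 1) = p by omega]) t
            (by omega) hk).mono le_rfl (Nat.le_succ _)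
        · exact (iha (k := k + 1) (Nat.succ_pos k)
            (by rw [show a + p + 1 + 1 - a = p + 2 by omega]; omega) t hb (by omega)).mono
              (Nat.le_succ _) le_rfl
      · have hlow_b := hlow' (a + p) (p + 1)
        refine HasChain.snoc ?_ (by simpa using hused) (by omega)
        rcases t with - | t
        · exact hasChain_zero used _ m _
        · exact ihb hk0 (by rwa [show a + p + 1 - a = p + 1 by omega]) t (by omega) (by omega)

theorem excess_middleRev_le_sub {s θ : ℕ} (hs : s ≤ θ) (hsr : s ≤ r - 1) (p : ℕ) :
    excess (middleRev n r) θ p ≤ p - s := by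
  rw [excess, ← Nat.card_Ico s p]
  refine card_le_card_of_injOn Fin.val (fun x hx => ?_) Fin.val_injective.injOn
  rw [coe_filter_univ, Set.mem_ofPred_eq, middleRev_val] at hx
  rw [coe_Ico, Set.mem_Ico]
  grind

theorem excess_middleRev_le_max_sub (θ p : ℕ) :
    excess (middleRev n r) θ p ≤ max p (n + 2 - r) - θ := by
  rw [excess, ← Nat.card_Ico θ]
  refine card_le_card_of_injOn (fun x => (middleRev n r x : ℕ)) (fun x hx => ?_)
    (Fin.val_injective.comp (middleRev n r).injective).injOn
  rw [coe_filter_univ, Set.mem_ofPred_eq, middleRev_val] at hx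
  simp only [coe_Ico, Set.mem_Ico, middleRev_val]
  grind

/-- An `r`-crossing is a diagonal of size `r` in the staircase of the cells `(a, b)` with `a < b`:
every first coordinate is less than every second one. -/
def HasCrossing (S : Set (ℕ × ℕ)) (r : ℕ) : Prop :=
  ∃ f g : Fin r → ℕ, StrictMono f ∧ StrictMono g ∧ (∀ i, (f i, g i) ∈ S) ∧ ∀ i j, f i < g j

theorem foldl_sortStep_middleRev_eq_one {used : ℕ × ℕ → Bool} (hr : 1 ≤ r)
    (hused : ¬ HasCrossing {c | used c = true} r) :
    ((stairWord n).map (Prod.map id used)).foldl sortStep (middleRev n r) = 1 := by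
  refine eq_one_of_excess_self_eq_zero fun θ => ?_
  rw [excess_foldl_sortStep, ← stairExcess]
  by_contra hθ
  have hpos := Nat.pos_of_ne_zero hθ
  rcases Nat.lt_or_ge (r - 1) θ with hrθ | hrθ
  · have hhigh := excess_middleRev_le_max_sub (n := n) (r := r) θ
    obtain ⟨m, rfl⟩ : ∃ m, n = θ + m := Nat.exists_eq_add_of_le <| by
      by_contra! hn
      have := hhigh θ
      rw [stairExcess, foldl_excessStep_of_lt _ _ hn] at hpos
      omega
    obtain ⟨f, g, hf, hg, hfg, hfm, hmg⟩ := hasChain_of_le_stairExcess (a := m + 1) (t := r) rfl hr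
      (excess_middleRev_le_sub hrθ.le le_rfl) hhigh zero_lt_one
      (by rwa [show θ + m + 1 - (m + 1) = θ by omega]) le_rfl (by omega)
    exact hused ⟨f, g, hf, hg, hfg, fun i j => (Nat.lt_succ_iff.1 (hfm i)).trans_lt (hmg j).1⟩
  · have := foldl_excessStep_le ((stairWord n).map (Prod.map id used))
      (excess_middleRev_le_sub (n := n) le_rfl hrθ) θ
    rw [← stairExcess] at this
    omega

end Chain

section Staircase

open MvPolynomial

variable {K : Type*} [Field K]

theorem InCell.det_of_stairWord_eq_zero {n r : ℕ} (hr : 1 ≤ r)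
    (hn : 2 * r ≤ n + 1) {x : ℕ × ℕ → K}
    (h : InCell (middleRev n r) (wordMatrix ((stairWord n).map (Prod.map id x))))
    {f g : Fin r → ℕ} (hfg : ∀ i j, f i < g j ∧ g j ≤ n) :
    (Matrix.of fun i j => x (f i, g j)).det = 0 := by
  rw [← Matrix.det_transpose, ← h.det_submatrix_eq_zero hr hn
    (fun i => ⟨g i, Nat.lt_succ_of_le (hfg i i).2⟩) (fun j => ⟨n - f j, by omega⟩)
    fun i j => by have := hfg j i; simp only; omega]
  congr 1
  ext i j
  have := hfg j i
  rw [Matrix.submatrix_apply, wordMatrix_stairWord_apply x (by simp only; omega)]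
  simp only [Matrix.transpose_apply, Matrix.of_apply, Nat.sub_sub_self (this.1.le.trans this.2)]

theorem eq_zero_of_vanishes_of_minors [Infinite K] {n r : ℕ} (hr : 1 ≤ r) (hn : 2 * r ≤ n + 1)
    {F : MvPolynomial (ℕ × ℕ) K} (hvars : ∀ c ∈ F.vars, c.1 < c.2 ∧ c.2 ≤ n)
    (hF : ∀ m ∈ F.support, ¬ HasCrossing (m.support : Set (ℕ × ℕ)) r)
    (hv : ∀ x : ℕ × ℕ → K, (∀ f g : Fin r → ℕ, (∀ i j, f i < g j ∧ g j ≤ n) →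
      (Matrix.of fun i j => x (f i, g j)).det = 0) → eval x F = 0) : F = 0 := by
  refine eq_zero_of_vanishes_on_cell_of_nodup (stairWord n) (nodup_map_snd_stairWord n)
    (middleRev n r) F (fun c hc => mem_map_snd_stairWord.2 (hvars c hc)) (fun m hm => ?_)
    fun x hx => hv x fun f g hfg => hx.det_of_stairWord_eq_zero hr hn hfg
  refine foldl_sortStep_middleRev_eq_one hr ?_
  convert hF m hm using 2
  ext c
  simp

end Staircase

/-! ### Initial ideals of determinantal ideals -/

section GroebnerBasis

open MvPolynomial

variable {V k : Type*} [Field k]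

theorem degree_eq_of_forall_support_le {ord : MonomialOrder V} {f : MvPolynomial V k} {m : V →₀ ℕ}
    (hm : m ∈ f.support) (h : ∀ m' ∈ f.support, ord.toSyn m' ≤ ord.toSyn m) :
    ord.degree f = m :=
  ord.toSyn.injective (le_antisymm (MonomialOrder.degree_le_iff.2 h) (ord.le_degree hm))

variable {ι : Type*} {ord : MonomialOrder V} {J : Ideal (MvPolynomial V k)}
  {b : ι → MvPolynomial V k}

theorem exists_degree_le_degree (hbJ : ∀ i, b i ∈ J) (hb : ∀ i, ord.Monic (b i))
    (hJ : ∀ f ∈ J, (∀ m ∈ f.support, ∀ i, ¬ ord.degree (b i) ≤ m) → f = 0)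
    {f : MvPolynomial V k} (hf : f ∈ J) (hf0 : f ≠ 0) : ∃ i, ord.degree (b i) ≤ ord.degree f := by
  obtain ⟨g, rem, hfg, hdeg, hrem⟩ := ord.div (fun i => (hb i).leadingCoeff_eq_one ▸ isUnit_one) f
  have hsum : Finsupp.linearCombination _ b g ∈ J :=
    Ideal.sum_mem _ fun i _ => J.mul_mem_left _ (hbJ i)
  have hrem0 : rem = 0 :=
    hJ rem (by rw [← add_sub_cancel_left (Finsupp.linearCombination _ b g) rem, ← hfg]
               exact J.sub_mem hf hsum) hrem
  have hcoeff : (Finsupp.linearCombination _ b g).coeff (ord.degree f) ≠ 0 := by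
    rw [← add_zero (Finsupp.linearCombination _ b g), ← hrem0, ← hfg]
    exact ord.leadingCoeff_ne_zero_iff.2 hf0
  rw [Finsupp.linearCombination_apply, Finsupp.sum, coeff_sum] at hcoeff
  obtain ⟨i, -, hi⟩ := Finset.exists_ne_zero_of_sum_ne_zero hcoeff
  rw [smul_eq_mul, mul_comm] at hi
  have hdegree : ord.degree (b i * g i) = ord.degree f :=
    ord.toSyn.injective (le_antisymm (hdeg i) (ord.le_degree (mem_support_iff.2 hi)))
  have hne : b i * g i ≠ 0 := fun h => hi (by rw [h, coeff_zero])
  exact ⟨i, by rw [← hdegree, ord.degree_mul' hne]; exact le_self_add⟩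

theorem initialIdeal_eq_span (hbJ : ∀ i, b i ∈ J) (hb : ∀ i, ord.Monic (b i))
    (hJ : ∀ f ∈ J, (∀ m ∈ f.support, ∀ i, ¬ ord.degree (b i) ≤ m) → f = 0) :
    initialIdeal ord J =
      Ideal.span ((fun m => monomial m (1 : k)) '' Set.range fun i => ord.degree (b i)) := by
  classical
  refine le_antisymm (Ideal.span_le.2 ?_) (Ideal.span_mono ?_)
  · rintro _ ⟨f, hf, rfl⟩
    rw [SetLike.mem_coe, leadingMonomial]
    split_ifs with hf0
    · exact Ideal.zero_mem _
    · obtain ⟨i, hi⟩ := exists_degree_le_degree hbJ hb hJ hf hf0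
      refine mem_ideal_span_monomial_image.2 fun m hm => ⟨_, ⟨i, rfl⟩, ?_⟩
      rwa [Finset.mem_singleton.1 (support_monomial_subset hm)]
  · rintro _ ⟨_, ⟨i, rfl⟩, rfl⟩
    exact ⟨b i, hbJ i, (if_neg (hb i).ne_zero).symm⟩

end GroebnerBasis

section SquarefreeMonomials

open MvPolynomial

variable {V : Type*}

/-- The exponent vector of the squarefree monomial with a given set of variables. -/
noncomputable def setExponent (S : Finset V) : V →₀ ℕ :=
  ∑ v ∈ S, Finsupp.single v 1

theorem setExponent_apply [DecidableEq V] (S : Finset V) (v : V) :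
    setExponent S v = if v ∈ S then 1 else 0 := by
  simp [setExponent, Finsupp.finsetSum_apply, Finsupp.single_apply]

theorem setExponent_le_iff {S : Finset V} {m : V →₀ ℕ} : setExponent S ≤ m ↔ S ⊆ m.support := by
  classical
  rw [Finsupp.le_def, Finset.subset_iff]
  refine forall_congr' fun v => ?_
  rw [setExponent_apply, Finsupp.mem_support_iff]
  split_ifs with hv <;> simp [hv, Nat.one_le_iff_ne_zero]

theorem setExponent_lt_setExponent [LinearOrder V] [Finite V] {S T : Finset V}
    (hcard : S.card = T.card) {v : V} (hvS : v ∈ S) (hvT : v ∉ T)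
    (h : ∀ w < v, w ∈ S ↔ w ∈ T) :
    (degRevLex V).toSyn (setExponent S) < (degRevLex V).toSyn (setExponent T) := by
  refine DegRevLex.lt_def.2 (Or.inr ⟨by simpa [setExponent] using hcard, v, fun w hw => ?_, ?_⟩)
  · simp only [setExponent_apply, h w hw]
  · simp [setExponent_apply, hvS, hvT]

variable (k : Type*) [Field k]

theorem stanleyReisnerIdeal_eq_span (Δ : LowerSet (Finset V)) :
    stanleyReisnerIdeal k Δ =
      Ideal.span ((fun m => monomial m (1 : k)) '' (setExponent '' {S | S ∉ Δ})) := by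
  have hprod : ∀ S : Finset V, (∏ v ∈ S, X v : MvPolynomial V k) = monomial (setExponent S) 1 :=
    fun S => (monomial_sum_one S _).symm
  rw [stanleyReisnerIdeal, Set.image_image]
  simp only [hprod, eq_comm, Set.image, Set.mem_ofPred_eq]

theorem isSquarefreeMonomialIdeal_stanleyReisnerIdeal (Δ : LowerSet (Finset V)) :
    IsSquarefreeMonomialIdeal (stanleyReisnerIdeal k Δ) := by
  classical
  refine ⟨setExponent '' {S | S ∉ Δ}, ?_, stanleyReisnerIdeal_eq_span k Δ⟩
  rintro _ ⟨S, -, rfl⟩ v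
  rw [setExponent_apply]
  split_ifs <;> simp

theorem stanleyReisnerIdeal_eq_span_of_notMem_iff {ι : Type*} {Δ : LowerSet (Finset V)}
    {D : ι → Finset V} (hD : ∀ S, S ∉ Δ ↔ ∃ i, D i ⊆ S) :
    stanleyReisnerIdeal k Δ =
      Ideal.span ((fun m => monomial m (1 : k)) '' Set.range fun i => setExponent (D i)) := by
  classical
  rw [stanleyReisnerIdeal_eq_span]
  refine le_antisymm (Ideal.span_le.2 ?_) (Ideal.span_mono (Set.image_mono ?_))
  · rintro _ ⟨_, ⟨S, hS, rfl⟩, rfl⟩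
    obtain ⟨i, hi⟩ := (hD S).1 hS
    refine mem_ideal_span_monomial_image.2 fun m hm => ⟨_, ⟨i, rfl⟩, ?_⟩
    rw [Finset.mem_singleton.1 (support_monomial_subset hm), setExponent_le_iff]
    refine fun v hv => Finsupp.mem_support_iff.2 ?_
    rw [setExponent_apply, if_pos (hi hv)]
    exact one_ne_zero
  · rintro _ ⟨i, rfl⟩
    exact ⟨D i, (hD _).2 ⟨i, subset_rfl⟩, rfl⟩

end SquarefreeMonomials

/-- An `r × r` subgrid of `Λ`: the rows and columns of a minor. -/
structure Subgrid (Λ : Finset (ℕ+ × ℕ+)) (r : ℕ) where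
  row : Fin r ↪o ℕ+
  col : Fin r ↪o ℕ+
  mem : ∀ i j, (row i, col j) ∈ Λ

namespace Subgrid

open MvPolynomial

variable {Λ : Finset (ℕ+ × ℕ+)} {r : ℕ} (g : Subgrid Λ r)

/-- The cell in the `i`-th row and the `j`-th column of the subgrid. -/
def cell (i j : Fin r) : Cell Λ := ⟨(g.row i, g.col j), g.mem i j⟩

theorem pos_cell (i j : Fin r) : (g.cell i j).pos = (g.row i, g.col j) := rfl

theorem cell_inj {i j i' j' : Fin r} : g.cell i j = g.cell i' j' ↔ i = i' ∧ j = j' := by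
  rw [← Cell.pos.injective.eq_iff, pos_cell, pos_cell, Prod.mk.injEq, g.row.injective.eq_iff,
    g.col.injective.eq_iff]

theorem cell_lt_cell {i j i' j' : Fin r} :
    g.cell i j < g.cell i' j' ↔ i' < i ∨ i = i' ∧ j < j' := by
  rw [Cell.lt_def, pos_cell, pos_cell, gt_iff_lt, g.row.lt_iff_lt, g.col.lt_iff_lt,
    g.row.injective.eq_iff]

/-- The cells whose variables occur in the term of a permutation in the Leibniz formula. -/
def permCells (σ : Equiv.Perm (Fin r)) : Finset (Cell Λ) :=
  Finset.univ.map ⟨fun j => g.cell (σ j) j, fun _ _ h => (g.cell_inj.1 h).2⟩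

theorem mem_permCells {σ : Equiv.Perm (Fin r)} {v : Cell Λ} :
    v ∈ g.permCells σ ↔ ∃ j, g.cell (σ j) j = v := by
  rw [permCells, Finset.mem_map]
  exact exists_congr fun _ => and_iff_right (Finset.mem_univ _)

theorem cell_mem_permCells {σ : Equiv.Perm (Fin r)} {i j : Fin r} :
    g.cell i j ∈ g.permCells σ ↔ σ j = i := by
  simp [mem_permCells, cell_inj]

/-- The cells on the main diagonal of the subgrid. -/
def diagonal : Finset (Cell Λ) := g.permCells 1

/-- At the largest row that `σ` does not fix, the permutation has a cell to the left of the
diagonal. It is smaller than all other cells in which the two terms differ. -/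
theorem setExponent_permCells_lt {σ : Equiv.Perm (Fin r)} (hσ : σ ≠ 1) :
    (degRevLex (Cell Λ)).toSyn (setExponent (g.permCells σ)) <
      (degRevLex (Cell Λ)).toSyn (setExponent g.diagonal) := by
  obtain ⟨i, hi, hfix⟩ := exists_apply_lt_of_ne_one (inv_ne_one.2 hσ)
  obtain ⟨j, rfl⟩ := σ.surjective i
  rw [← Equiv.Perm.mul_apply, inv_mul_cancel, Equiv.Perm.one_apply] at hi
  have hfix' : ∀ l, σ j < l → σ l = l := fun l hl => (Equiv.Perm.inv_eq_iff_eq.1 (hfix l hl)).symm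
  refine setExponent_lt_setExponent (by simp [diagonal, permCells])
    (g.cell_mem_permCells.2 rfl) (fun h => hi.ne (g.cell_mem_permCells.1 h)) fun v hv => ?_
  suffices h : ∀ a b, g.cell a b < g.cell (σ j) j → (σ b = a ↔ b = a) by
    constructor <;> rw [diagonal, mem_permCells] <;> rintro ⟨b, rfl⟩
    · exact g.cell_mem_permCells.2 ((h _ _ hv).1 rfl)
    · exact g.cell_mem_permCells.2 ((h _ _ hv).2 rfl)
  intro a b hab
  rcases g.cell_lt_cell.1 hab with ha | ⟨rfl, hb⟩
  · rw [← σ.injective.eq_iff (a := b), hfix' a ha]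
  · rw [σ.injective.eq_iff]
    exact iff_of_false hb.ne (hb.trans hi).ne

variable (k : Type*) [Field k]

/-- The minor with the rows and columns of the subgrid. -/
noncomputable def minor : MvPolynomial (Cell Λ) k :=
  (Matrix.of fun i j => X (g.cell i j)).det

theorem minor_eq_sum :
    g.minor k = ∑ σ : Equiv.Perm (Fin r), monomial (setExponent (g.permCells σ))
      ((Equiv.Perm.sign σ : ℤ) : k) := by
  rw [minor, Matrix.det_apply']
  refine Finset.sum_congr rfl fun σ _ => ?_
  rw [← mul_one ((Equiv.Perm.sign σ : ℤ) : k), ← C_mul_monomial, setExponent, monomial_sum_one,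
    permCells, Finset.prod_map, map_intCast]
  rfl

theorem coeff_minor_diagonal : (g.minor k).coeff (setExponent g.diagonal) = 1 := by
  classical
  rw [minor_eq_sum, coeff_sum, Finset.sum_eq_single 1]
  · simp [diagonal]
  · intro σ _ hσ
    rw [coeff_monomial, if_neg]
    intro h
    exact (g.setExponent_permCells_lt hσ).ne (congrArg _ h)
  · simp

theorem degree_minor :
    (degRevLex (Cell Λ)).degree (g.minor k) = setExponent g.diagonal := by
  classical
  refine degree_eq_of_forall_support_le ?_ fun m hm => ?_
  · rw [mem_support_iff, coeff_minor_diagonal]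
    exact one_ne_zero
  · rw [minor_eq_sum] at hm
    obtain ⟨σ, -, hσ⟩ := Finset.mem_biUnion.1 (support_sum hm)
    rw [Finset.mem_singleton.1 (support_monomial_subset hσ)]
    rcases eq_or_ne σ 1 with rfl | h1
    · rfl
    · exact (g.setExponent_permCells_lt h1).le

theorem monic_minor : (degRevLex (Cell Λ)).Monic (g.minor k) := by
  rw [MonomialOrder.Monic, MonomialOrder.leadingCoeff, degree_minor, coeff_minor_diagonal]

theorem map_minor {R : Type*} [CommRing R] (φ : MvPolynomial (Cell Λ) k →+* R) :
    φ (g.minor k) = (Matrix.of fun i j => φ (X (g.cell i j))).det :=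
  φ.map_det _

end Subgrid

section DeterminantalIdeal

variable {Λ : Finset (ℕ+ × ℕ+)} {r : ℕ}

theorem determinantalIdeal_eq_span (k : Type*) [Field k] (Λ : Finset (ℕ+ × ℕ+)) (r : ℕ) :
    determinantalIdeal k Λ r = Ideal.span (Set.range fun g : Subgrid Λ r => g.minor k) := by
  have hminor : ∀ g : Subgrid Λ r,
      g.minor k = ((genericMatrix k Λ).submatrix g.row g.col).det := fun g => by
    rw [Subgrid.minor]
    congr 1
    ext1 i j
    rw [Matrix.submatrix_apply, genericMatrix, dif_pos (g.mem i j)]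
    rfl
  refine le_antisymm (Ideal.span_le.2 ?_) (Ideal.span_mono ?_)
  · rintro _ ⟨α, β, hα, hβ, rfl⟩
    rw [SetLike.mem_coe, minorOf]
    split_ifs with h
    · refine Ideal.subset_span ⟨⟨α.orderEmbOfFin hα, β.orderEmbOfFin hβ, fun i j => ?_⟩,
        hminor _⟩
      exact h (Finset.mk_mem_product (α.orderEmbOfFin_mem hα i) (β.orderEmbOfFin_mem hβ j))
    · exact Ideal.zero_mem _
  · rintro _ ⟨g, rfl⟩
    have hcard : ∀ e : Fin r ↪o ℕ+, (Finset.univ.map e.toEmbedding).card = r := by simp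
    refine ⟨_, _, hcard g.row, hcard g.col, ?_⟩
    rw [minorOf, if_pos, ← Finset.orderEmbOfFin_unique' _ (f := g.row) (by simp),
      ← Finset.orderEmbOfFin_unique' _ (f := g.col) (by simp)]
    · exact hminor g
    · simp only [Finset.subset_iff, Finset.mem_product, Finset.mem_map]
      rintro ⟨_, _⟩ ⟨⟨i, -, rfl⟩, ⟨j, -, rfl⟩⟩
      exact g.mem i j

theorem notMem_diagonalFreeComplex_iff (S : Finset (Cell Λ)) :
    S ∉ diagonalFreeComplex Λ r ↔ ∃ g : Subgrid Λ r, g.diagonal ⊆ S := by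
  have hdiag : ∀ g : Subgrid Λ r, g.diagonal.map Cell.pos =
      Finset.univ.image fun i => (g.row i, g.col i) := fun g => by
    ext p
    simp [Subgrid.diagonal, Subgrid.mem_permCells, Subgrid.pos_cell]
  refine not_not.trans ⟨?_, ?_⟩
  · rintro ⟨_, ⟨a, b, ha, hb, h, rfl⟩, hS⟩
    let g : Subgrid Λ r := ⟨.ofStrictMono a ha, .ofStrictMono b hb, h⟩
    exact ⟨g, Finset.map_subset_map.1 ((hdiag g).trans_subset hS)⟩
  · rintro ⟨g, hg⟩
    exact ⟨_, ⟨g.row, g.col, g.row.strictMono, g.col.strictMono, g.mem, rfl⟩,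
      (hdiag g).symm.trans_subset (Finset.map_subset_map.2 hg)⟩

end DeterminantalIdeal

section StackPolyomino

open Finset MvPolynomial

/-- The largest row that meets one of the first `b` columns of `Λ`. -/
def prefixHeight (Λ : Finset (ℕ+ × ℕ+)) (b : ℕ) : ℕ :=
  {p ∈ Λ | (p.2 : ℕ) ≤ b}.sup fun p => (p.1 : ℕ)

/-- The row `a`, moved by the number of columns that come before the first cell in a row `≥ a`. The
count starts with a column `0` and ends with the last column of `Λ`. -/
def stairRow (Λ : Finset (ℕ+ × ℕ+)) (a : ℕ) : ℕ :=
  a + #{b ∈ range (Λ.sup (fun p => (p.2 : ℕ)) + 1) | prefixHeight Λ b < a}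

/-- The column `b`, moved by the number of rows that meet one of the first `b` columns. -/
def stairCol (Λ : Finset (ℕ+ × ℕ+)) (b : ℕ) : ℕ :=
  b + prefixHeight Λ b + 1

variable {Λ : Finset (ℕ+ × ℕ+)}

theorem le_prefixHeight {a b : ℕ+} (h : (a, b) ∈ Λ) : (a : ℕ) ≤ prefixHeight Λ b :=
  le_sup (f := fun p : ℕ+ × ℕ+ => (p.1 : ℕ)) (mem_filter.2 ⟨h, le_refl (b : ℕ)⟩)

theorem prefixHeight_mono : Monotone (prefixHeight Λ) := fun _ _ h =>
  sup_mono (monotone_filter_right _ fun _ _ hp => hp.trans h)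

theorem stairCol_strictMono : StrictMono (stairCol Λ) := fun _ _ h =>
  Nat.succ_lt_succ (add_lt_add_of_lt_of_le h (prefixHeight_mono h.le))

theorem stairRow_strictMono : StrictMono (stairRow Λ) := fun _ _ h =>
  add_lt_add_of_lt_of_le h (card_le_card (monotone_filter_right _ fun _ _ hb => hb.trans h))

theorem stairRow_lt_stairCol_iff {p : ℕ+ × ℕ+} (hp : p ∈ Λ) {a : ℕ} :
    stairRow Λ a < stairCol Λ p.2 ↔ a ≤ prefixHeight Λ p.2 := by
  have hb : (p.2 : ℕ) ≤ Λ.sup fun p => (p.2 : ℕ) := le_sup (f := fun p => (p.2 : ℕ)) hp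
  rw [stairRow, stairCol]
  constructor
  · contrapose!
    intro h
    have := card_le_card (s := range (p.2 + 1)) (t := {b ∈ range (Λ.sup (fun p => (p.2 : ℕ)) + 1) |
      prefixHeight Λ b < a}) fun b hb' => mem_filter.2
        ⟨mem_range.2 (by have := mem_range.1 hb'; omega),
          (prefixHeight_mono (Nat.lt_succ_iff.1 (mem_range.1 hb'))).trans_lt h⟩
    rw [card_range] at this
    omega
  · intro h
    have := card_le_card (s := {b ∈ range (Λ.sup (fun p => (p.2 : ℕ)) + 1) |
      prefixHeight Λ b < a}) (t := range p.2) fun b hb' =>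
        mem_range.2 (prefixHeight_mono.reflect_lt ((mem_filter.1 hb').2.trans_le h))
    rw [card_range] at this
    omega

/-- The position of a cell in the staircase. Rows and columns are moved apart so that a row comes
before a column exactly if some cell lies weakly above the row and weakly left of the column. -/
def stairPos (v : Cell Λ) : ℕ × ℕ :=
  (stairRow Λ v.pos.1, stairCol Λ v.pos.2)

theorem stairPos_injective : Function.Injective (stairPos : Cell Λ → ℕ × ℕ) := fun _ _ h =>
  Cell.pos.injective (Prod.ext
    (PNat.coe_injective (stairRow_strictMono.injective (congrArg Prod.fst h)))
    (PNat.coe_injective (stairCol_strictMono.injective (congrArg Prod.snd h))))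

theorem Subgrid.stairRow_lt_stairCol {r : ℕ} (g : Subgrid Λ r) (i j : Fin r) :
    stairRow Λ (g.row i) < stairCol Λ (g.col j) :=
  (stairRow_lt_stairCol_iff (g.mem i j)).2 (le_prefixHeight (g.mem i j))

theorem IsStackPolyomino.mem_of_le_prefixHeight (hΛ : IsStackPolyomino Λ) {a b c : ℕ+}
    (hab : (a, b) ∈ Λ) (hcb : c ≤ b) (h : (a : ℕ) ≤ prefixHeight Λ c) : (a, c) ∈ Λ := by
  obtain ⟨p, hp, hle⟩ := (Finset.le_sup_iff (by simp)).1 h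
  rw [mem_filter] at hp
  have hap : (a, p.2) ∈ Λ := hΛ.column p.1 p.2 hp.1 a (by exact_mod_cast hle)
  exact hΛ.row a p.2 b hap hab c (by exact_mod_cast hp.2) hcb

theorem IsStackPolyomino.exists_diagonal_subset_of_hasCrossing (hΛ : IsStackPolyomino Λ) {r : ℕ}
    {S : Finset (Cell Λ)} (h : HasCrossing (stairPos '' (S : Set (Cell Λ))) r) :
    ∃ g : Subgrid Λ r, g.diagonal ⊆ S := by
  obtain ⟨f, g, hf, hg, hS, hlt⟩ := h
  choose v hvS hv using hS
  have hrow : ∀ i, stairRow Λ (v i).pos.1 = f i := fun i => congrArg Prod.fst (hv i)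
  have hcol : ∀ i, stairCol Λ (v i).pos.2 = g i := fun i => congrArg Prod.snd (hv i)
  have hmem : ∀ i, (v i).pos ∈ Λ := fun i => (v i).2
  have ha : StrictMono fun i => (v i).pos.1 := fun i j hij => by
    simpa only [← hrow, stairRow_strictMono.lt_iff_lt, PNat.coe_lt_coe] using hf hij
  have hb : StrictMono fun i => (v i).pos.2 := fun i j hij => by
    simpa only [← hcol, stairCol_strictMono.lt_iff_lt, PNat.coe_lt_coe] using hg hij
  refine ⟨⟨.ofStrictMono _ ha, .ofStrictMono _ hb, fun i j => ?_⟩, fun w hw => ?_⟩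
  · rcases le_total i j with hij | hij
    · exact hΛ.column _ _ (hmem j) _ (ha.monotone hij)
    · have hlt' : stairRow Λ (v i).pos.1 < stairCol Λ (v j).pos.2 := by
        rw [hrow, hcol]
        exact hlt i j
      exact hΛ.mem_of_le_prefixHeight (hmem i) (hb.monotone hij)
        ((stairRow_lt_stairCol_iff (hmem j)).1 hlt')
  · obtain ⟨i, rfl⟩ := (Subgrid.mem_permCells _).1 hw
    exact hvS i

variable {k : Type*} [Field k] {r : ℕ}

theorem map_eq_zero_of_mem_determinantalIdeal {K : Type*} [CommRing K]
    {φ : MvPolynomial (Cell Λ) k →+* K}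
    (hφ : ∀ g : Subgrid Λ r, (Matrix.of fun i j => φ (X (g.cell i j))).det = 0)
    {F : MvPolynomial (Cell Λ) k} (hF : F ∈ determinantalIdeal k Λ r) : φ F = 0 := by
  suffices h : determinantalIdeal k Λ r ≤ RingHom.ker φ from h hF
  rw [determinantalIdeal_eq_span, Ideal.span_le]
  rintro _ ⟨g, rfl⟩
  exact (g.map_minor k φ).trans (hφ g)

theorem eq_zero_of_mem_determinantalIdeal (hΛ : IsStackPolyomino Λ) (hr : 1 ≤ r)
    {F : MvPolynomial (Cell Λ) k} (hF : F ∈ determinantalIdeal k Λ r)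
    (hstd : ∀ m ∈ F.support, m.support ∈ diagonalFreeComplex Λ r) : F = 0 := by
  classical
  -- The argument with curves needs an infinite field.
  let φ := algebraMap k (AlgebraicClosure k)
  obtain ⟨n, hn, hle⟩ : ∃ n, 2 * r ≤ n + 1 ∧ ∀ p ∈ Λ, stairCol Λ p.2 ≤ n :=
    ⟨2 * r + Λ.sup fun p => stairCol Λ p.2, by omega, fun p hp =>
      (le_sup (f := fun p : ℕ+ × ℕ+ => stairCol Λ p.2) hp).trans (Nat.le_add_left _ _)⟩
  refine map_injective φ φ.injective (rename_injective stairPos stairPos_injective ?_)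
  rw [map_zero, map_zero]
  refine eq_zero_of_vanishes_of_minors hr hn (fun c hc => ?_) (fun m hm hcross => ?_)
    fun x hx => ?_
  · obtain ⟨v, -, rfl⟩ := Finset.mem_image.1 (vars_rename _ _ hc)
    exact ⟨(stairRow_lt_stairCol_iff v.2).2 (le_prefixHeight v.2), hle _ v.2⟩
  · rw [support_rename_of_injective stairPos_injective, Finset.mem_image] at hm
    obtain ⟨m, hm, rfl⟩ := hm
    rw [Finsupp.mapDomain_support_of_injective stairPos_injective, coe_image] at hcross
    exact (notMem_diagonalFreeComplex_iff _).2
      (hΛ.exists_diagonal_subset_of_hasCrossing hcross) (hstd m (support_map_subset φ F hm))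
  · rw [eval_rename, eval_map]
    refine map_eq_zero_of_mem_determinantalIdeal (φ := eval₂Hom φ (x ∘ stairPos)) (fun g => ?_) hF
    simp only [coe_eval₂Hom, eval₂_X]
    exact hx _ _ fun i j => ⟨g.stairRow_lt_stairCol i j, hle _ (g.mem i j)⟩

end StackPolyomino

theorem theorem5p4 (k : Type*) [Field k] (Λ : Finset (ℕ+ × ℕ+)) (hΛ : IsStackPolyomino Λ)
    (r : ℕ) (hr : 1 ≤ r) :
    initialIdeal (degRevLex (Cell Λ)) (determinantalIdeal k Λ r) =
        stanleyReisnerIdeal k (diagonalFreeComplex Λ r) ∧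
      IsSquarefreeMonomialIdeal
        (initialIdeal (degRevLex (Cell Λ)) (determinantalIdeal k Λ r)) := by
  have hmem (g : Subgrid Λ r) : g.minor k ∈ determinantalIdeal k Λ r := by
    rw [determinantalIdeal_eq_span]
    exact Ideal.subset_span ⟨g, rfl⟩
  have hface {m : Cell Λ →₀ ℕ}
      (hm : ∀ g : Subgrid Λ r, ¬ (degRevLex (Cell Λ)).degree (g.minor k) ≤ m) :
      m.support ∈ diagonalFreeComplex Λ r := by
    by_contra h
    obtain ⟨g, hg⟩ := (notMem_diagonalFreeComplex_iff _).1 h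
    exact hm g (by rwa [g.degree_minor, setExponent_le_iff])
  have heq : initialIdeal (degRevLex (Cell Λ)) (determinantalIdeal k Λ r) =
      stanleyReisnerIdeal k (diagonalFreeComplex Λ r) := by
    rw [initialIdeal_eq_span hmem (fun g => g.monic_minor k) fun f hf hstd =>
        eq_zero_of_mem_determinantalIdeal hΛ hr hf fun m hm => hface (hstd m hm),
      stanleyReisnerIdeal_eq_span_of_notMem_iff k notMem_diagonalFreeComplex_iff]
    simp only [Subgrid.degree_minor]
  exact ⟨heq, heq ▸ isSquarefreeMonomialIdeal_stanleyReisnerIdeal k _⟩
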